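/- Let $k$ be a field of characteristic zero, $R=k[t]$, and let $A_1=k[t,\partial]$ (with $\partial t-t\partial=1$) be the first Weyl algebra, acting on $R$ by polynomial differential operators; let $Q_1$ be its quotient division ring. The $t$-degree of a non-zero element of $A_1$ is the least $n$ such that it can be written as $\sum_{i\le n}t^ic_i(\partial)$ with $c_i(\partial)\in k[\partial]$; it is extended to $Q_1\setminus\{0\}$ by $\deg_t(b^{-1}a)=\deg_t a-\deg_t b$. For a $k$-subspace $V$ of $R$ put $S(V)=\{a\in R: aV\subseteq V\}$ and $\mathcal D(R,V)=\{d\in A_1: d(R)\subseteq V\}$, a right ideal of $A_1$. For $b\in R$ put $\mathcal O(b)=\{a\in R: a'\in bR\}$. A non-zero subspace $V$ of $R$ is primary decomposable if $\mathcal O(b)\subseteq S(V)$ for some $b\ne 0$, and it is then called irreducible if it is not contained in a proper ideal of $R$. For a right ideal $I$ of $A_1$ let $I^*=\{u\in Q_1: uI\subseteq A_1\}$ and $H(I)=\{\sigma\in\mathrm{Aut}_k(A_1): \sigma(I)\cong I \text{ as right } A_1\text{-modules}\}$, and write $H(V)=H(\mathcal D(R,V))$. If $I\neq 0$, the characteristic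 elements of $I$ are the elements $f\in I$ and $e^*\in I^*$, each unique up to a factor in $k^*$, such that the non-zero elements of minimal $t$-degree of $I$, together with $0$, form exactly the set $f\,k[\partial]$, and the non-zero elements of minimal $t$-degree of $I^*$, together with $0$, form exactly the set $k[\partial]\,e^*$. The characteristic elements of $\mathcal D(R,V)$ are also called the characteristic elements of $V$. Let $V$ and $W$ be primary decomposable irreducible subspaces of $k[t]$ such that $H(V)\subseteq H(W)$. If $e_V^*\in\mathcal D(R,V)^*$, $f_V\in\mathcal D(R,V)$ are the characteristic elements of $V$, and $e_W^*\in\mathcal D(R,W)^*$, $f_W\in\mathcal D(R,W)$ are those of $W$, then $$e_V^*f_V\in e_W^*f_W\,k[\partial].$$ -/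

import Mathlib

open Polynomial
open scoped nonZeroDivisors

namespace Weyl

/-! ### The first Weyl algebra -/

section WeylAlgebra

variable (k : Type*) [Field k]

/-- Multiplication by the variable `t` on the polynomial ring `k[t]`. -/
noncomputable def mulT : Module.End k k[X] := LinearMap.mulLeft k (X : k[X])

/-- The derivation `∂ = d/dt` of the polynomial ring `k[t]`. -/
noncomputable def ddt : Module.End k k[X] := Polynomial.derivative

/-- The relation `∂ t - t ∂ = 1`. -/
lemma ddt_mul_mulT : ddt k * mulT k = mulT k * ddt k + 1 := by
  refine LinearMap.ext fun p => ?_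
  simp [ddt, mulT, derivative_mul, add_comm]

/-- The first Weyl algebra `A₁ = k[t, ∂]`, realised (for `k` of characteristic zero) as the algebra
of polynomial differential operators, i.e. the `k`-subalgebra of `End_k(k[t])` generated by
multiplication by `t` and by `∂`. -/
noncomputable def weylAlgebra : Subalgebra k (Module.End k k[X]) :=
  Algebra.adjoin k {mulT k, ddt k}

/-- The first Weyl algebra as a type. -/
def A₁ : Type _ := ↥(weylAlgebra k)

noncomputable instance : Ring (A₁ k) := inferInstanceAs (Ring ↥(weylAlgebra k))

noncomputable instance : Algebra k (A₁ k) := inferInstanceAs (Algebra k ↥(weylAlgebra k))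

instance : Nontrivial (A₁ k) := inferInstanceAs (Nontrivial ↥(weylAlgebra k))

/-- The action of `A₁` on `k[t]`. -/
noncomputable def act : A₁ k →ₐ[k] Module.End k k[X] := (weylAlgebra k).val

lemma act_injective : Function.Injective (act k) := Subtype.val_injective

lemma act_mem (d : A₁ k) : act k d ∈ weylAlgebra k := Subtype.property (p := (· ∈ weylAlgebra k)) d

lemma mulT_mem : mulT k ∈ weylAlgebra k := Algebra.subset_adjoin (by simp)

lemma ddt_mem : ddt k ∈ weylAlgebra k := Algebra.subset_adjoin (by simp)

/-- The element of `A₁` given by a differential operator. -/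
def mkA (d : Module.End k k[X]) (hd : d ∈ weylAlgebra k) : A₁ k :=
  (⟨d, hd⟩ : ↥(weylAlgebra k))

@[simp] lemma act_mkA (d : Module.End k k[X]) (hd : d ∈ weylAlgebra k) :
    act k (mkA k d hd) = d := rfl

/-- The element `t` of `A₁`. -/
noncomputable def t : A₁ k := mkA k (mulT k) (mulT_mem k)

/-- The element `∂` of `A₁`. -/
noncomputable def del : A₁ k := mkA k (ddt k) (ddt_mem k)

lemma del_mul_t : del k * t k - t k * del k = 1 := by
  apply act_injective k
  rw [map_sub, map_mul, map_mul, map_one]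
  change ddt k * mulT k - mulT k * ddt k = 1
  rw [ddt_mul_mulT]; abel

/-- The subring `k[∂]` of `A₁`. -/
noncomputable def polyDel : Subalgebra k (A₁ k) := Algebra.adjoin k {del k}

end WeylAlgebra

/-! ### `A₁` has no zero divisors

The commutator with `t` is a locally nilpotent derivation whose kernel consists of the
multiplication operators. -/

section Domain

variable {k : Type*} [Field k]

/-- The commutator with `t`. -/
noncomputable def adT : Module.End k k[X] →ₗ[k] Module.End k k[X] :=
  LinearMap.mulRight k (mulT k) - LinearMap.mulLeft k (mulT k)

lemma adT_apply (d : Module.End k k[X]) : adT d = d * mulT k - mulT k * d := rfl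

lemma adT_mul (a b : Module.End k k[X]) : adT (a * b) = adT a * b + a * adT b := by
  simp only [adT_apply, sub_mul, mul_sub, mul_assoc]; abel

lemma adT_pow_mul_eq_zero (n m : ℕ) (a b : Module.End k k[X])
    (ha : (adT ^ n) a = 0) (hb : (adT ^ m) b = 0) : (adT ^ (n + m)) (a * b) = 0 := by
  induction hN : n + m generalizing n m a b with
  | zero =>
    obtain ⟨rfl, rfl⟩ : n = 0 ∧ m = 0 := by omega
    have : a = 0 := by simpa using ha
    simp [this]
  | succ N ih =>
    rcases n with _ | n
    · have : a = 0 := by simpa using ha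
      simp [this]
    rcases m with _ | m
    · have : b = 0 := by simpa using hb
      simp [this]
    rw [pow_succ, Module.End.mul_apply, adT_mul, map_add,
      ih n (m + 1) (adT a) b (by rwa [pow_succ] at ha) hb (by omega),
      ih (n + 1) m a (adT b) ha (by rwa [pow_succ] at hb) (by omega), add_zero]

lemma adT_pow_mul_top (n m : ℕ) (a b : Module.End k k[X])
    (ha : (adT ^ (n + 1)) a = 0) (hb : (adT ^ (m + 1)) b = 0) :
    (adT ^ (n + m)) (a * b) = ((n + m).choose n : k) • ((adT ^ n) a * (adT ^ m) b) := by
  induction hN : n + m generalizing n m a b with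
  | zero =>
    obtain ⟨rfl, rfl⟩ : n = 0 ∧ m = 0 := by omega
    simp
  | succ N ih =>
    have ha' : (adT ^ n) (adT a) = 0 := by rwa [pow_succ] at ha
    have hb' : (adT ^ m) (adT b) = 0 := by rwa [pow_succ] at hb
    rw [pow_succ, Module.End.mul_apply, adT_mul, map_add]
    rcases n with _ | n
    · rcases m with _ | m
      · omega
      have h0 : adT a = 0 := by simpa using ha
      have := ih 0 m a (adT b) ha hb' (by omega)
      rw [this]
      simp [h0, pow_succ]
    rcases m with _ | m
    · have h0 : adT b = 0 := by simpa using hb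
      have := ih n 0 (adT a) b ha' hb (by omega)
      obtain rfl : n = N := by omega
      rw [this]
      simp [h0, pow_succ]
    rw [ih n (m + 1) (adT a) b ha' hb (by omega), ih (n + 1) m a (adT b) ha hb' (by omega),
      Nat.choose_succ_succ]
    push_cast
    rw [add_smul]
    simp [pow_succ]

lemma adT_nilpotent (d : Module.End k k[X]) (hd : d ∈ weylAlgebra k) :
    ∃ n, (adT ^ n) d = 0 := by
  induction hd using Algebra.adjoin_induction with
  | mem x hx =>
    rcases hx with rfl | rfl
    · exact ⟨1, by simp [adT_apply]⟩
    · refine ⟨2, ?_⟩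
      rw [pow_two, Module.End.mul_apply, adT_apply (ddt k), ddt_mul_mulT, add_sub_cancel_left,
        adT_apply]
      simp
  | algebraMap r => exact ⟨1, by simp [adT_apply, Algebra.commutes]⟩
  | add x y _ _ hx hy =>
    obtain ⟨n, hn⟩ := hx
    obtain ⟨m, hm⟩ := hy
    refine ⟨n + m, ?_⟩
    rw [map_add, pow_add, Module.End.mul_apply, Module.End.mul_apply, hm, ← Module.End.mul_apply,
      ← pow_add, add_comm n m, pow_add, Module.End.mul_apply, hn]
    simp
  | mul x y _ _ hx hy =>
    obtain ⟨n, hn⟩ := hx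
    obtain ⟨m, hm⟩ := hy
    exact ⟨n + m, adT_pow_mul_eq_zero n m x y hn hm⟩

lemma eq_mul_of_adT_eq_zero (d : Module.End k k[X]) (h : adT d = 0) (p : k[X]) :
    d p = p * d 1 := by
  have hX (q : k[X]) : d (X * q) = X * d q := by
    have h' : d * mulT k = mulT k * d := sub_eq_zero.mp (by rw [← adT_apply, h])
    exact LinearMap.congr_fun h' q
  have hXn (n : ℕ) : d (X ^ n) = X ^ n * d 1 := by
    induction n with
    | zero => simp
    | succ n ih => rw [pow_succ', hX, ih, mul_assoc]
  induction p using Polynomial.induction_on' with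
  | add p q hp hq => rw [map_add, hp, hq, add_mul]
  | monomial n a =>
    rw [← Polynomial.smul_X_eq_monomial, map_smul, hXn, smul_mul_assoc]

lemma exists_top (d : Module.End k k[X]) (hd : d ∈ weylAlgebra k) (h0 : d ≠ 0) :
    ∃ n, (adT ^ (n + 1)) d = 0 ∧ (adT ^ n) d ≠ 0 := by
  classical
  have h := adT_nilpotent d hd
  have hpos : Nat.find h ≠ 0 := by
    intro h1
    have := Nat.find_spec h
    rw [h1] at this
    exact h0 (by simpa using this)
  obtain ⟨n, hn⟩ := Nat.exists_eq_succ_of_ne_zero hpos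
  exact ⟨n, by simpa [hn] using Nat.find_spec h, Nat.find_min h (by omega)⟩

instance [CharZero k] : NoZeroDivisors (A₁ k) where
  eq_zero_or_eq_zero_of_mul_eq_zero := by
    intro a' b' hab
    by_contra! hne
    have ha := act_mem k a'
    have hb := act_mem k b'
    have ha0 : act k a' ≠ 0 := (map_ne_zero_iff _ (act_injective k)).mpr hne.1
    have hb0 : act k b' ≠ 0 := (map_ne_zero_iff _ (act_injective k)).mpr hne.2
    have hab0 : act k a' * act k b' = 0 := by rw [← map_mul, hab, map_zero]
    generalize act k a' = a at ha ha0 hab0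
    generalize act k b' = b at hb hb0 hab0
    obtain ⟨n, hn, hn'⟩ := exists_top a ha ha0
    obtain ⟨m, hm, hm'⟩ := exists_top b hb hb0
    have key := adT_pow_mul_top n m a b hn hm
    rw [hab0, map_zero] at key
    have hc : ((n + m).choose n : k) ≠ 0 :=
      Nat.cast_ne_zero.mpr (Nat.choose_pos (by omega)).ne'
    have key' := (smul_eq_zero.mp key.symm).resolve_left hc
    rw [pow_succ', Module.End.mul_apply] at hn hm
    have e1 := eq_mul_of_adT_eq_zero _ hn
    have e2 := eq_mul_of_adT_eq_zero _ hm
    have hz : (adT ^ m) b 1 * (adT ^ n) a 1 = 0 := by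
      rw [← e1, ← Module.End.mul_apply, key']; rfl
    rcases mul_eq_zero.mp hz with h | h
    · exact hm' (LinearMap.ext fun p => by rw [e2, h]; simp)
    · exact hn' (LinearMap.ext fun p => by rw [e1, h]; simp)

end Domain

/-! ### `A₁` satisfies the Ore condition

Dimension count for the filtration by the powers of `span {1, t, ∂}`. -/

section Ore

variable (k : Type*) [Field k]

/-- The span of `1, t, ∂`. -/
noncomputable def gen : Submodule k (Module.End k k[X]) := Submodule.span k {1, mulT k, ddt k}

/-- The span of the monomials `t ^ i ∂ ^ j` with `i, j ≤ n`. -/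
noncomputable def box (n : ℕ) : Submodule k (Module.End k k[X]) :=
  Submodule.span k (Set.range fun ij : Fin (n + 1) × Fin (n + 1) =>
    mulT k ^ (ij.1 : ℕ) * ddt k ^ (ij.2 : ℕ))

variable {k}

lemma mem_box {n i j : ℕ} (hi : i ≤ n) (hj : j ≤ n) : mulT k ^ i * ddt k ^ j ∈ box k n :=
  Submodule.subset_span ⟨(⟨i, by omega⟩, ⟨j, by omega⟩), rfl⟩

lemma ddt_mul_mulT_pow (i : ℕ) :
    ddt k * mulT k ^ i = mulT k ^ i * ddt k + (i : k) • mulT k ^ (i - 1) := by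
  induction i with
  | zero => simp
  | succ i ih =>
    rw [pow_succ, ← mul_assoc, ih, add_mul, mul_assoc, ddt_mul_mulT, smul_mul_assoc]
    rcases i with _ | i
    · simp
    · rw [Nat.add_sub_cancel, Nat.add_sub_cancel, ← pow_succ, mul_add, mul_one, ← mul_assoc,
        Nat.cast_succ (i + 1), add_smul, one_smul, add_assoc,
        add_comm (mulT k ^ (i + 1)) (((i + 1 : ℕ) : k) • mulT k ^ (i + 1))]

lemma gen_pow_le_box (n : ℕ) : gen k ^ n ≤ box k n := by
  induction n with
  | zero =>
    rw [pow_zero, Submodule.one_le]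
    simpa using mem_box (k := k) (n := 0) (i := 0) (j := 0) le_rfl le_rfl
  | succ n ih =>
    rw [pow_succ']
    refine (mul_le_mul' le_rfl ih).trans ?_
    rw [gen, box, Submodule.span_mul_span, Submodule.span_le]
    rintro _ ⟨a, ha, _, ⟨⟨⟨i, hi⟩, ⟨j, hj⟩⟩, rfl⟩, rfl⟩
    simp only [SetLike.mem_coe]
    rcases ha with rfl | rfl | rfl
    · rw [one_mul]; exact mem_box (by omega) (by omega)
    · rw [← mul_assoc, ← pow_succ']; exact mem_box (by omega) (by omega)
    · rw [← mul_assoc, ddt_mul_mulT_pow, add_mul, mul_assoc, ← pow_succ', smul_mul_assoc]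
      exact Submodule.add_mem _ (mem_box (by omega) (by omega))
        (Submodule.smul_mem _ _ (mem_box (by omega) (by omega)))

instance (n : ℕ) : FiniteDimensional k (box k n) :=
  FiniteDimensional.span_of_finite k (Set.finite_range _)

lemma finrank_box_le (n : ℕ) : Module.finrank k (box k n) ≤ (n + 1) ^ 2 := by
  refine (finrank_range_le_card _).trans ?_
  simp [pow_two]

instance (n : ℕ) : FiniteDimensional k ↥(gen k ^ n) :=
  Submodule.finiteDimensional_of_le (gen_pow_le_box n)

lemma finrank_gen_pow_le (n : ℕ) : Module.finrank k ↥(gen k ^ n) ≤ (n + 1) ^ 2 :=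
  (Submodule.finrank_mono (gen_pow_le_box n)).trans (finrank_box_le n)

lemma one_le_gen : (1 : Submodule k (Module.End k k[X])) ≤ gen k :=
  Submodule.one_le.mpr (Submodule.subset_span (by simp))

lemma gen_pow_mono {n m : ℕ} (h : n ≤ m) : gen k ^ n ≤ gen k ^ m :=
  pow_le_pow_right' one_le_gen h

lemma exists_mem_gen_pow (d : Module.End k k[X]) (hd : d ∈ weylAlgebra k) :
    ∃ c, d ∈ gen k ^ c := by
  induction hd using Algebra.adjoin_induction with
  | mem x hx =>
    refine ⟨1, ?_⟩
    rw [pow_one]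
    exact Submodule.subset_span (by rcases hx with rfl | rfl <;> simp)
  | algebraMap r => exact ⟨0, by rw [pow_zero]; exact Submodule.algebraMap_mem r⟩
  | add x y _ _ hx hy =>
    obtain ⟨n, hn⟩ := hx
    obtain ⟨m, hm⟩ := hy
    exact ⟨n + m, Submodule.add_mem _ (gen_pow_mono (by omega) hn) (gen_pow_mono (by omega) hm)⟩
  | mul x y _ _ hx hy =>
    obtain ⟨n, hn⟩ := hx
    obtain ⟨m, hm⟩ := hy
    exact ⟨n + m, by rw [pow_add]; exact Submodule.mul_mem_mul hn hm⟩

lemma gen_pow_le (n : ℕ) : gen k ^ n ≤ Subalgebra.toSubmodule (weylAlgebra k) := by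
  have h1 : gen k ≤ Subalgebra.toSubmodule (weylAlgebra k) := by
    refine Submodule.span_le.mpr ?_
    rintro x (rfl | rfl | rfl)
    · exact one_mem (weylAlgebra k)
    · exact mulT_mem k
    · exact ddt_mem k
  induction n with
  | zero => rw [pow_zero]; exact Submodule.one_le.mpr (one_mem (weylAlgebra k))
  | succ n ih =>
    rw [pow_succ, Submodule.mul_le]
    intro a ha b hb
    exact mul_mem (S := Subalgebra k (Module.End k k[X])) (ih ha) (h1 hb)

lemma exists_finrank_lt (c : ℕ) :
    ∃ n, Module.finrank k ↥(gen k ^ (n + c)) < 2 * Module.finrank k ↥(gen k ^ n) := by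
  by_contra! h
  have h2 (m : ℕ) : 2 ^ m ≤ Module.finrank k ↥(gen k ^ (m * c)) := by
    induction m with
    | zero =>
      rw [pow_zero, zero_mul, pow_zero]
      have h0 : (1 : Submodule k (Module.End k k[X])) ≠ ⊥ := one_ne_zero
      have h1 : FiniteDimensional k (1 : Submodule k (Module.End k k[X])) := by
        rw [← pow_zero (gen k)]; infer_instance
      exact Submodule.one_le_finrank_iff.mpr h0
    | succ m ih =>
      have := h (m * c)
      rw [Nat.succ_mul, pow_succ]
      omega
  obtain ⟨l, hl⟩ : ∃ l, l = 4 * c + 1 := ⟨_, rfl⟩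
  have h3 := (h2 (4 * l)).trans (finrank_gen_pow_le _)
  have h4 : l + 1 ≤ 2 ^ l := Nat.lt_two_pow_self
  have h5 : 4 * l * c + 1 < (l + 1) ^ 2 := by subst hl; nlinarith
  have h6 : (l + 1) ^ 2 ≤ (2 ^ l) ^ 2 := Nat.pow_le_pow_left h4 2
  have h7 : (4 * l * c + 1) ^ 2 < ((2 ^ l) ^ 2) ^ 2 := Nat.pow_lt_pow_left (by omega) (by norm_num)
  have h8 : ((2 ^ l) ^ 2) ^ 2 = 2 ^ (4 * l) := by rw [← pow_mul, ← pow_mul]; congr 1; ring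
  omega

lemma ore_condition [CharZero k] (r : A₁ k) (s : (A₁ k)⁰) :
    ∃ (r' : A₁ k) (s' : (A₁ k)⁰), s' * r = r' * s := by
  obtain ⟨c, hc⟩ := exists_mem_gen_pow (act k r) (act_mem k r)
  obtain ⟨c', hc'⟩ := exists_mem_gen_pow (act k s.1) (act_mem k s.1)
  have hr : act k r ∈ gen k ^ (c + c') := gen_pow_mono (by omega) hc
  have hs : act k s.1 ∈ gen k ^ (c + c') := gen_pow_mono (by omega) hc'
  obtain ⟨n, hn⟩ := exists_finrank_lt (k := k) (c + c')
  let φ : (↥(gen k ^ n) × ↥(gen k ^ n)) →ₗ[k] ↥(gen k ^ (n + (c + c'))) :=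
    LinearMap.codRestrict _
      ((LinearMap.mulRight k (act k r)).comp ((gen k ^ n).subtype.comp (LinearMap.fst k _ _)) -
        (LinearMap.mulRight k (act k s.1)).comp
          ((gen k ^ n).subtype.comp (LinearMap.snd k _ _)))
      (fun xy => by
        rw [pow_add]
        exact Submodule.sub_mem _ (Submodule.mul_mem_mul xy.1.2 hr)
          (Submodule.mul_mem_mul xy.2.2 hs))
  have hfree : Module.Free k ↥(gen k ^ n) := Module.Free.of_divisionRing k ↥(gen k ^ n)
  have hker : LinearMap.ker φ ≠ ⊥ :=
    LinearMap.ker_ne_bot_of_finrank_lt (K := k) (V := ↥(gen k ^ n) × ↥(gen k ^ n))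
      (V₂ := ↥(gen k ^ (n + (c + c')))) (f := φ) (by rw [Module.finrank_prod]; omega)
  obtain ⟨⟨x, y⟩, hxy, hne⟩ := (Submodule.ne_bot_iff _).mp hker
  have he : x.1 * act k r = y.1 * act k s.1 :=
    sub_eq_zero.mp (congrArg Subtype.val (LinearMap.mem_ker.mp hxy))
  obtain ⟨x', hx'⟩ : ∃ x' : A₁ k, act k x' = x.1 := ⟨mkA k x.1 (gen_pow_le n x.2), rfl⟩
  obtain ⟨y', hy'⟩ : ∃ y' : A₁ k, act k y' = y.1 := ⟨mkA k y.1 (gen_pow_le n y.2), rfl⟩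
  have he' : x' * r = y' * s.1 := act_injective k (by rw [map_mul, map_mul, hx', hy', he])
  have hx : x' ≠ 0 := by
    intro h0
    rw [h0, zero_mul] at he'
    have hy0 : y' = 0 :=
      (mul_eq_zero.mp he'.symm).resolve_right (nonZeroDivisors.ne_zero s.2)
    apply hne
    have e1 : x = 0 := Subtype.ext (by rw [← hx', h0, map_zero]; rfl)
    have e2 : y = 0 := Subtype.ext (by rw [← hy', hy0, map_zero]; rfl)
    rw [e1, e2]; rfl
  exact ⟨y', ⟨x', mem_nonZeroDivisors_of_ne_zero hx⟩, he'⟩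

noncomputable instance [CharZero k] : OreLocalization.OreSet (A₁ k)⁰ :=
  (OreLocalization.nonempty_oreSet_iff_of_noZeroDivisors (R := A₁ k) (S := (A₁ k)⁰).mpr
    (fun r s => ore_condition r s)).some

end Ore

/-! ### The `t`-degree on `A₁` -/

section TDegree

variable {k : Type*} [Field k]

variable (k) in
/-- The operators `∑_{i ≤ n} tⁱ cᵢ(∂)` with `cᵢ(∂) ∈ k[∂]`, i.e. those of `t`-degree at most `n`. -/
noncomputable def tDegreeLE (n : ℕ) : Submodule k (A₁ k) :=
  Submodule.span k {x | ∃ i j : ℕ, i ≤ n ∧ x = t k ^ i * del k ^ j}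

lemma exists_mem_tDegreeLE (d : A₁ k) : ∃ n, d ∈ tDegreeLE k n := by
  obtain ⟨n, hn⟩ := exists_mem_gen_pow (act k d) (act_mem k d)
  refine ⟨n, ?_⟩
  have hle : box k n ≤ (tDegreeLE k n).map (act k).toLinearMap := by
    refine Submodule.span_le.mpr ?_
    rintro _ ⟨⟨i, j⟩, rfl⟩
    refine ⟨t k ^ (i : ℕ) * del k ^ (j : ℕ),
      Submodule.subset_span ⟨i, j, Nat.le_of_lt_succ i.2, rfl⟩, ?_⟩
    change act k (t k ^ (i : ℕ) * del k ^ (j : ℕ)) = _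
    rw [map_mul, map_pow, map_pow]
    rfl
  obtain ⟨d', hd', h⟩ := hle (gen_pow_le_box n hn)
  rwa [← act_injective k h]

/-- The `t`-degree of a non-zero element of `A₁`: the least `n` such that it can be written as
`∑_{i ≤ n} tⁱ cᵢ(∂)` (the value at `0` is irrelevant). -/
noncomputable def tDegree (d : A₁ k) : ℕ := sInf {n | d ∈ tDegreeLE k n}

end TDegree

/-! ### The quotient division ring and its `t`-degree -/

section Quotient

variable (k : Type*) [Field k] [CharZero k]

/-- The quotient division ring `Q₁` of `A₁` (the Ore localization at all non-zero elements). -/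
def Q₁ : Type _ := OreLocalization (A₁ k)⁰ (A₁ k)

noncomputable instance : DivisionRing (Q₁ k) :=
  inferInstanceAs (DivisionRing (OreLocalization (A₁ k)⁰ (A₁ k)))

/-- The inclusion `A₁ ⊆ Q₁`. -/
noncomputable def toQ : A₁ k →+* Q₁ k :=
  (OreLocalization.numeratorRingHom : A₁ k →+* OreLocalization (A₁ k)⁰ (A₁ k))

lemma toQ_injective : Function.Injective (toQ k) :=
  OreLocalization.numeratorHom_inj (R := A₁ k) (S := (A₁ k)⁰) inf_le_left

variable {k}

/-- Every element of `Q₁` is a fraction `b⁻¹ a`. -/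
lemma exists_eq_inv_mul (q : Q₁ k) : ∃ a b : A₁ k, b ≠ 0 ∧ q = (toQ k b)⁻¹ * toQ k a := by
  have key : ∀ x : OreLocalization (A₁ k)⁰ (A₁ k), ∃ a b : A₁ k, b ≠ 0 ∧
      OreLocalization.numeratorHom (S := (A₁ k)⁰) b * x =
        OreLocalization.numeratorHom (S := (A₁ k)⁰) a := by
    intro x
    induction x with
    | _ a b =>
      exact ⟨a, b, nonZeroDivisors.ne_zero b.2, OreLocalization.mul_cancel⟩
  obtain ⟨a, b, hb, h⟩ := key q
  refine ⟨a, b, hb, ?_⟩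
  have h' : toQ k b * q = toQ k a := h
  rw [← h', inv_mul_cancel_left₀]
  exact (map_ne_zero_iff _ (toQ_injective k)).mpr hb

/-- The `t`-degree on `Q₁`: `b⁻¹ a` has `t`-degree `deg_t a - deg_t b` for non-zero `a, b`. -/
def HasTDegree (q : Q₁ k) (n : ℤ) : Prop :=
  ∃ a b : A₁ k, a ≠ 0 ∧ b ≠ 0 ∧ q = (toQ k b)⁻¹ * toQ k a ∧ n = (tDegree a : ℤ) - tDegree b

end Quotient

/-! ### Right ideals, duals and characteristic elements -/

section Ideals

variable {k : Type*} [Field k]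

variable (k) in
/-- Right ideals of `A₁`. -/
abbrev RightIdeal : Type _ := Submodule (A₁ k)ᵐᵒᵖ (A₁ k)

/-- The image `σ(I)` of a right ideal under an automorphism of `A₁`. -/
def RightIdeal.image (σ : A₁ k ≃ₐ[k] A₁ k) (I : RightIdeal k) : RightIdeal k where
  carrier := σ '' (I : Set (A₁ k))
  zero_mem' := ⟨0, I.zero_mem, map_zero σ⟩
  add_mem' := by
    rintro _ _ ⟨x, hx, rfl⟩ ⟨y, hy, rfl⟩
    exact ⟨x + y, I.add_mem hx hy, map_add σ x y⟩
  smul_mem' := by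
    rintro c _ ⟨x, hx, rfl⟩
    refine ⟨x * σ.symm c.unop, I.smul_mem (MulOpposite.op (σ.symm c.unop)) hx, ?_⟩
    rw [map_mul, AlgEquiv.apply_symm_apply]
    rfl

/-- The (underlying set of the) Stafford subgroup `H(I)`: the `k`-automorphisms `σ` of `A₁` such
that `σ(I)` is isomorphic to `I` as a right `A₁`-module. -/
def stafford (I : RightIdeal k) : Set (A₁ k ≃ₐ[k] A₁ k) :=
  {σ | Nonempty (RightIdeal.image σ I ≃ₗ[(A₁ k)ᵐᵒᵖ] I)}

/-- For a subspace `V` of `R = k[t]`, the right ideal `𝒟(R, V)` of all `d ∈ A₁` with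
`d(R) ⊆ V`. -/
def diffIdeal (V : Submodule k k[X]) : RightIdeal k where
  carrier := {d | ∀ p : k[X], act k d p ∈ V}
  zero_mem' p := by simp
  add_mem' := by
    intro a b ha hb p
    rw [map_add, LinearMap.add_apply]
    exact V.add_mem (ha p) (hb p)
  smul_mem' := by
    intro c x hx p
    change act k (x * c.unop) p ∈ V
    rw [map_mul, Module.End.mul_apply]
    exact hx _

/-- `f` is the characteristic element of the right ideal `I` lying in `I`: the elements of `I` of
minimal `t`-degree (together with `0`) are exactly the elements of `f k[∂]`. -/
def IsCharElem (I : RightIdeal k) (f : A₁ k) : Prop :=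
  f ∈ I ∧ ∀ x : A₁ k,
    (x = 0 ∨ (x ∈ I ∧ ∀ y ∈ I, y ≠ 0 → tDegree x ≤ tDegree y)) ↔ ∃ c ∈ polyDel k, x = f * c

variable [CharZero k]

/-- The dual `I^* = {u ∈ Q₁ : u I ⊆ A₁}`. -/
def dual (I : RightIdeal k) : Set (Q₁ k) :=
  {u | ∀ d ∈ I, ∃ a : A₁ k, u * toQ k d = toQ k a}

/-- `e` is the characteristic element of `I` lying in the dual `I^*`: the elements of `I^*` of
minimal `t`-degree (together with `0`) are exactly the elements of `k[∂] e`. -/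
def IsDualCharElem (I : RightIdeal k) (e : Q₁ k) : Prop :=
  e ∈ dual I ∧ ∀ x : Q₁ k,
    (x = 0 ∨ (x ∈ dual I ∧ ∃ n, HasTDegree x n ∧
      ∀ y ∈ dual I, y ≠ 0 → ∀ m, HasTDegree y m → n ≤ m)) ↔ ∃ c ∈ polyDel k, x = toQ k c * e

end Ideals

/-! ### Primary decomposable subspaces -/

section PrimaryDecomposable

variable {k : Type*} [Field k]

/-- `𝒪(b) = {a ∈ R : a' ∈ b R}`. -/
def ringO (b : k[X]) : Set k[X] := {a | derivative a ∈ Ideal.span {b}}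

/-- `S(V) = {a ∈ R : a V ⊆ V}`. -/
def stabilizer (V : Submodule k k[X]) : Set k[X] := {a | ∀ v ∈ V, a * v ∈ V}

/-- A subspace `V` of `k[t]` is primary decomposable if it is non-zero and `S(V)` contains `𝒪(b)`
for some `b ≠ 0`. -/
def IsPrimaryDecomposable (V : Submodule k k[X]) : Prop :=
  V ≠ ⊥ ∧ ∃ b : k[X], b ≠ 0 ∧ ringO b ⊆ stabilizer V

/-- A primary decomposable subspace is irreducible if it lies in no proper ideal of `k[t]`. -/
def IsPDI (V : Submodule k k[X]) : Prop :=
  IsPrimaryDecomposable V ∧ ∀ J : Ideal k[X], J ≠ ⊤ → ¬ ((V : Set k[X]) ⊆ J)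

end PrimaryDecomposable

end Weyl

/-! For a non-zero right ideal `I` with characteristic elements `f` and `e`, put `M = f⁻¹ I` inside
`Q₁`. Then `M` is a right `A₁`-module containing `A₁`, and all its elements have the form `a h⁻¹`
with `h ∈ k[∂]`. For fixed `h`, the admissible numerators `a` form `quotientSubmodule I f h`; this
keeps most of the argument inside `A₁`. The element `v = e f` lies in `k[∂]`
(`exists_polyDel_eq_mul`), and `v M = e I ⊆ A₁`.

The link with `H(I)` is through the automorphisms `σ = exp(ad P(∂))`, which fix `k[∂]`. If `P(∂) M ⊆
M`, then `ad P(∂)`, hence `σ`, preserves `M`, and left multiplication by `f σ(f)⁻¹` gives `σ(I) ≅ I`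
(`expAut_mem_stafford`). Conversely, if `exp(ad s P(∂))` is in `H(I)` for all `s ∈ k`, minimality of
the degree of `f` forces each isomorphism to send `f` to a scalar multiple of itself, so these
automorphisms preserve `M`. Extracting the coefficient of `s` gives `P(∂) M ⊆ M`
(`mul_mem_quotientSubmodule_of_mem_stafford`).

For `V`, every `P(∂) ∈ v k[∂]` satisfies `P(∂) M_V ⊆ A₁ ⊆ M_V`. Since `H(V) ⊆ H(W)`, it follows that
`v k[∂] M_W ⊆ M_W`. A descent on the `t`-degree improves this to `v M_W ⊆ A₁`, that is, `v f_W⁻¹ ∈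
I_W^*`. The product of this element with `f_W` is in `k[∂]`, so it has minimal degree and belongs to
`k[∂] e_W^*` (`exists_eq_mul_of_forall_mul_mem`). -/

namespace Weyl

/-! ### Iterated inner derivations -/

section InnerDerivation

variable (K : Type*) {R : Type*} [CommRing K] [Ring R] [Algebra K R]

/-- The inner derivation `x ↦ p x - x p`. -/
noncomputable def ad (p : R) : Module.End K R := LinearMap.mulLeft K p - LinearMap.mulRight K p

lemma ad_apply (p x : R) : ad K p x = p * x - x * p := rfl

lemma ad_mul (p x y : R) : ad K p (x * y) = ad K p x * y + x * ad K p y := by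
  simp only [ad_apply, sub_mul, mul_sub, mul_assoc]; abel

variable {K}

lemma ad_eq_zero {p x : R} (h : Commute p x) : ad K p x = 0 := sub_eq_zero.mpr h

lemma commute_of_ad_eq_zero {p x : R} (h : ad K p x = 0) : Commute p x := sub_eq_zero.mp h

lemma ad_pow_mul_of_commute {p c : R} (h : Commute p c) (n : ℕ) (x : R) :
    (ad K p ^ n) (x * c) = (ad K p ^ n) x * c := by
  induction n generalizing x with
  | zero => rfl
  | succ n ih =>
    rw [pow_succ, Module.End.mul_apply, Module.End.mul_apply, ad_mul, ad_eq_zero h, mul_zero,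
      add_zero, ih]

lemma ad_pow_commute_mul {p c : R} (h : Commute p c) (n : ℕ) (x : R) :
    (ad K p ^ n) (c * x) = c * (ad K p ^ n) x := by
  induction n generalizing x with
  | zero => rfl
  | succ n ih =>
    rw [pow_succ, Module.End.mul_apply, Module.End.mul_apply, ad_mul, ad_eq_zero h, zero_mul,
      zero_add, ih]

lemma ad_pow_comm {p q : R} (h : Commute p q) (n : ℕ) (x : R) :
    (ad K p ^ n) (ad K q x) = ad K q ((ad K p ^ n) x) := by
  rw [ad_apply, ad_apply, map_sub, ad_pow_mul_of_commute h, ad_pow_commute_mul h]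

lemma ad_pow_eq_zero_of_le {p x : R} {n m : ℕ} (hnm : n ≤ m) (h : (ad K p ^ n) x = 0) :
    (ad K p ^ m) x = 0 := by
  obtain ⟨l, rfl⟩ := Nat.exists_eq_add_of_le' hnm
  rw [pow_add, Module.End.mul_apply, h, map_zero]

/-- In the Leibniz expansion the only surviving term is the one with `n` derivations on `a` and `m`
on `b`. This makes the `t`-degree additive and leading coefficients multiplicative up to a binomial
factor. -/
lemma ad_pow_mul_top (p : R) (n m : ℕ) (a b : R)
    (ha : (ad K p ^ (n + 1)) a = 0) (hb : (ad K p ^ (m + 1)) b = 0) :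
    (ad K p ^ (n + m)) (a * b) =
      (n + m).choose n • ((ad K p ^ n) a * (ad K p ^ m) b) := by
  induction hN : n + m generalizing n m a b with
  | zero =>
    obtain ⟨rfl, rfl⟩ : n = 0 ∧ m = 0 := by omega
    simp
  | succ N ih =>
    have ha' : (ad K p ^ n) (ad K p a) = 0 := by rwa [pow_succ] at ha
    have hb' : (ad K p ^ m) (ad K p b) = 0 := by rwa [pow_succ] at hb
    rw [pow_succ, Module.End.mul_apply, ad_mul, map_add]
    rcases n with _ | n
    · rcases m with _ | m
      · omega
      have h0 : ad K p a = 0 := by simpa using ha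
      rw [ih 0 m a (ad K p b) ha hb' (by omega)]
      simp [h0, pow_succ]
    rcases m with _ | m
    · have h0 : ad K p b = 0 := by simpa using hb
      have := ih n 0 (ad K p a) b ha' hb (by omega)
      obtain rfl : n = N := by omega
      rw [this]
      simp [h0, pow_succ]
    rw [ih n (m + 1) (ad K p a) b ha' hb (by omega), ih (n + 1) m a (ad K p b) ha hb' (by omega),
      Nat.choose_succ_succ, add_smul]
    simp [pow_succ]

lemma ad_pow_succ_mul_eq_zero (p : R) (n m : ℕ) (a b : R)
    (ha : (ad K p ^ (n + 1)) a = 0) (hb : (ad K p ^ (m + 1)) b = 0) :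
    (ad K p ^ (n + m + 1)) (a * b) = 0 := by
  rw [pow_succ', Module.End.mul_apply, ad_pow_mul_top p n m a b ha hb, map_nsmul, ad_mul]
  rw [pow_succ', Module.End.mul_apply] at ha hb
  simp [ha, hb]

/-- Leibniz rule for the iterates of an inner derivation. -/
lemma ad_pow_mul (p : R) (n : ℕ) (a b : R) :
    (ad K p ^ n) (a * b) = ∑ ij ∈ Finset.HasAntidiagonal.antidiagonal n,
      n.choose ij.1 • ((ad K p ^ ij.1) a * (ad K p ^ ij.2) b) := by
  induction n with
  | zero => simp
  | succ n ih =>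
    rw [Finset.sum_antidiagonal_choose_succ_nsmul
      (fun i j => (ad K p ^ i) a * (ad K p ^ j) b) n, pow_succ', Module.End.mul_apply, ih,
      map_sum, ← Finset.sum_add_distrib]
    refine Finset.sum_congr rfl fun ij hij => ?_
    have h : n.choose ij.1 = n.choose ij.2 :=
      (Nat.choose_symm_of_eq_add (Finset.HasAntidiagonal.mem_antidiagonal.mp hij).symm)
    rw [map_nsmul, ad_mul, pow_succ', pow_succ', Module.End.mul_apply, Module.End.mul_apply,
      smul_add, ← h, add_comm]

end InnerDerivation

/-! ### The `t`-degree as order of nilpotency of `ad ∂` -/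

section Degree

variable {k : Type*} [Field k]

lemma aeval_del_mem (P : k[X]) : aeval (del k) P ∈ polyDel k := by
  rw [polyDel, Algebra.adjoin_singleton_eq_range_aeval]; exact ⟨P, rfl⟩

lemma mem_polyDel {c : A₁ k} : c ∈ polyDel k ↔ ∃ P : k[X], c = aeval (del k) P := by
  rw [polyDel, Algebra.adjoin_singleton_eq_range_aeval]
  exact ⟨fun ⟨P, h⟩ => ⟨P, h.symm⟩, fun ⟨P, h⟩ => ⟨P, h.symm⟩⟩

lemma del_mem_polyDel : del k ∈ polyDel k := Algebra.subset_adjoin rfl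

lemma commute_of_mem_polyDel {c d : A₁ k} (hc : c ∈ polyDel k) (hd : d ∈ polyDel k) :
    Commute c d := by
  obtain ⟨P, rfl⟩ := mem_polyDel.mp hc
  obtain ⟨S, rfl⟩ := mem_polyDel.mp hd
  rw [Commute, SemiconjBy, ← map_mul, mul_comm, map_mul]

lemma commute_del {c : A₁ k} (hc : c ∈ polyDel k) : Commute (del k) c :=
  commute_of_mem_polyDel del_mem_polyDel hc

lemma ad_del_t : ad k (del k) (t k) = 1 := by rw [ad_apply, del_mul_t]

lemma ad_del_pow_t_pow (n : ℕ) : (ad k (del k) ^ (n + 1)) (t k ^ n) = 0 ∧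
    (ad k (del k) ^ n) (t k ^ n) = n.factorial • 1 := by
  induction n with
  | zero => simp [ad_apply]
  | succ n ih =>
    have h2 : (ad k (del k) ^ (1 + 1)) (t k) = 0 := by
      rw [pow_succ, pow_one, Module.End.mul_apply, ad_del_t, ad_apply]; simp
    rw [pow_succ (t k)]
    refine ⟨ad_pow_succ_mul_eq_zero _ _ _ _ _ ih.1 h2, ?_⟩
    rw [ad_pow_mul_top _ _ _ _ _ ih.1 h2, ih.2, pow_one, ad_del_t,
      Nat.choose_succ_self_right, Nat.factorial_succ, mul_one, mul_smul]

lemma tDegreeLE_mono {n m : ℕ} (h : n ≤ m) : tDegreeLE k n ≤ tDegreeLE k m :=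
  Submodule.span_mono fun _ ⟨i, j, hi, hx⟩ => ⟨i, j, hi.trans h, hx⟩

lemma exists_eq_add_of_mem_tDegreeLE {n : ℕ} {x : A₁ k} (hx : x ∈ tDegreeLE k (n + 1)) :
    ∃ c ∈ polyDel k, ∃ y ∈ tDegreeLE k n, x = t k ^ (n + 1) * c + y := by
  induction hx using Submodule.span_induction with
  | mem x hx =>
    obtain ⟨i, j, hi, rfl⟩ := hx
    rcases Nat.lt_or_ge n i with h | h
    · obtain rfl : i = n + 1 := by omega
      exact ⟨_, pow_mem del_mem_polyDel j, 0, zero_mem _, by simp⟩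
    · exact ⟨0, zero_mem _, _, Submodule.subset_span ⟨i, j, h, rfl⟩, by simp⟩
  | zero => exact ⟨0, zero_mem _, 0, zero_mem _, by simp⟩
  | add x x' _ _ h h' =>
    obtain ⟨c, hc, y, hy, rfl⟩ := h
    obtain ⟨c', hc', y', hy', rfl⟩ := h'
    exact ⟨c + c', add_mem hc hc', y + y', add_mem hy hy', by rw [mul_add]; abel⟩
  | smul r x _ h =>
    obtain ⟨c, hc, y, hy, rfl⟩ := h
    exact ⟨r • c, (polyDel k).smul_mem hc r, r • y, Submodule.smul_mem _ r hy, by simp⟩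

lemma mem_tDegreeLE_zero {x : A₁ k} : x ∈ tDegreeLE k 0 → x ∈ polyDel k := by
  intro hx
  induction hx using Submodule.span_induction with
  | mem x hx =>
    obtain ⟨i, j, hi, rfl⟩ := hx
    obtain rfl : i = 0 := by omega
    simpa using pow_mem del_mem_polyDel j
  | zero => exact zero_mem _
  | add x x' _ _ h h' => exact add_mem h h'
  | smul r x _ h => exact (polyDel k).smul_mem h r

lemma ad_del_pow_eq_zero_of_mem {n : ℕ} {x : A₁ k} (hx : x ∈ tDegreeLE k n) :
    (ad k (del k) ^ (n + 1)) x = 0 := by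
  have hle : tDegreeLE k n ≤ LinearMap.ker (ad k (del k) ^ (n + 1)) := by
    refine Submodule.span_le.mpr ?_
    rintro _ ⟨i, j, hi, rfl⟩
    rw [SetLike.mem_coe, LinearMap.mem_ker,
      ad_pow_mul_of_commute (commute_del (pow_mem del_mem_polyDel j)),
      ad_pow_eq_zero_of_le (by omega) (ad_del_pow_t_pow i).1, zero_mul]
  exact hle hx

lemma exists_ad_del_pow_eq_zero (x : A₁ k) : ∃ n, (ad k (del k) ^ n) x = 0 := by
  obtain ⟨n, hn⟩ := exists_mem_tDegreeLE x
  exact ⟨n + 1, ad_del_pow_eq_zero_of_mem hn⟩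

variable [CharZero k]

instance : CharZero (A₁ k) := charZero_of_injective_algebraMap (algebraMap k (A₁ k)).injective

/-- Since `ad ∂` acts as `d/dt` on coefficients written on the right, applying it `N + 1` times to
an element of degree at most `N + 1` returns `(N + 1)!` times its top coefficient. In characteristic
zero that coefficient can therefore be shown to vanish. -/
lemma mem_tDegreeLE_iff {n : ℕ} {x : A₁ k} :
    x ∈ tDegreeLE k n ↔ (ad k (del k) ^ (n + 1)) x = 0 := by
  refine ⟨ad_del_pow_eq_zero_of_mem, fun h => ?_⟩
  obtain ⟨N, hN⟩ := exists_mem_tDegreeLE x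
  induction N with
  | zero => exact tDegreeLE_mono (Nat.zero_le _) hN
  | succ N ih =>
    rcases Nat.lt_or_ge N n with hlt | hge
    · exact tDegreeLE_mono hlt hN
    refine ih ?_
    obtain ⟨c, hc, y, hy, rfl⟩ := exists_eq_add_of_mem_tDegreeLE hN
    have h' := ad_pow_eq_zero_of_le (show n + 1 ≤ N + 1 by omega) h
    rw [map_add, ad_pow_mul_of_commute (commute_del hc), (ad_del_pow_t_pow (N + 1)).2,
      ad_del_pow_eq_zero_of_mem hy, add_zero, smul_mul_assoc, one_mul] at h'
    have hc0 : c = 0 := (smul_eq_zero.mp h').resolve_left (Nat.factorial_ne_zero _)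
    simpa [hc0] using hy

lemma mem_polyDel_iff_commute {x : A₁ k} : x ∈ polyDel k ↔ Commute (del k) x := by
  refine ⟨commute_del, fun h => mem_tDegreeLE_zero (mem_tDegreeLE_iff.mpr ?_)⟩
  simpa using ad_eq_zero h

lemma tDegree_le_iff {n : ℕ} {x : A₁ k} : tDegree x ≤ n ↔ (ad k (del k) ^ (n + 1)) x = 0 := by
  rw [← mem_tDegreeLE_iff]
  exact ⟨fun h => tDegreeLE_mono h (Nat.sInf_mem (exists_mem_tDegreeLE x)), fun h => Nat.sInf_le h⟩

lemma ad_del_pow_tDegree_succ (x : A₁ k) : (ad k (del k) ^ (tDegree x + 1)) x = 0 :=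
  tDegree_le_iff.mp le_rfl

lemma ad_del_pow_tDegree_ne_zero {x : A₁ k} (hx : x ≠ 0) : (ad k (del k) ^ tDegree x) x ≠ 0 := by
  intro h
  rcases hn : tDegree x with _ | n
  · rw [hn] at h; exact hx (by simpa using h)
  · rw [hn] at h
    have := tDegree_le_iff.mpr h
    omega

lemma tDegree_eq_of {n : ℕ} {x : A₁ k} (h : (ad k (del k) ^ (n + 1)) x = 0)
    (h' : (ad k (del k) ^ n) x ≠ 0) : tDegree x = n := by
  refine le_antisymm (tDegree_le_iff.mpr h) ?_
  by_contra! hlt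
  exact h' (ad_pow_eq_zero_of_le hlt (ad_del_pow_tDegree_succ x))

lemma tDegree_mul {x y : A₁ k} (hx : x ≠ 0) (hy : y ≠ 0) :
    tDegree (x * y) = tDegree x + tDegree y := by
  have h1 := ad_del_pow_tDegree_succ x
  have h2 := ad_del_pow_tDegree_succ y
  refine tDegree_eq_of ?_ ?_
  · exact ad_pow_succ_mul_eq_zero _ _ _ _ _ h1 h2
  · rw [ad_pow_mul_top _ _ _ _ _ h1 h2]
    have h3 : (ad k (del k) ^ tDegree x) x * (ad k (del k) ^ tDegree y) y ≠ 0 :=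
      mul_ne_zero (ad_del_pow_tDegree_ne_zero hx) (ad_del_pow_tDegree_ne_zero hy)
    exact smul_ne_zero (Nat.choose_pos (Nat.le_add_right _ _)).ne' h3

lemma tDegree_eq_zero_iff {x : A₁ k} : tDegree x = 0 ↔ x ∈ polyDel k := by
  rw [mem_polyDel_iff_commute, ← Nat.le_zero, tDegree_le_iff,
    show ad k (del k) ^ (0 + 1) = ad k (del k) from pow_one _]
  exact ⟨commute_of_ad_eq_zero, ad_eq_zero⟩

lemma ad_del_pow_mem_polyDel {n : ℕ} {x : A₁ k} (h : (ad k (del k) ^ (n + 1)) x = 0) :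
    (ad k (del k) ^ n) x ∈ polyDel k := by
  rw [pow_succ', Module.End.mul_apply] at h
  exact mem_polyDel_iff_commute.mpr (commute_of_ad_eq_zero h)

end Degree
-- Division in right ideals up to factors from `k[∂]`
section Division

variable {k : Type*} [Field k]

lemma mul_mem_of_mem {I : RightIdeal k} {x : A₁ k} (hx : x ∈ I) (a : A₁ k) : x * a ∈ I :=
  I.smul_mem (MulOpposite.op a) hx

/-- An explicit Ore condition turning a right denominator into a left one. As `ad h` lowers the
nilpotency order of `a`, the commutator of `h` and `a` is handled by induction. -/
lemma exists_pow_mul_eq {h : A₁ k} (hh : h ∈ polyDel k) [CharZero k] {n : ℕ} {a : A₁ k}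
    (ha : (ad k (del k) ^ n) a = 0) : ∃ b, h ^ n * a = b * h := by
  induction n generalizing a with
  | zero => exact ⟨0, by simpa using ha⟩
  | succ n ih =>
    have h1 : (ad k (del k) ^ n) (ad k h a) = 0 := by
      rw [ad_pow_comm (commute_del hh)]
      exact ad_eq_zero (commute_of_mem_polyDel hh (ad_del_pow_mem_polyDel ha))
    obtain ⟨b, hb⟩ := ih h1
    refine ⟨b + h ^ n * a, ?_⟩
    rw [ad_apply, mul_sub, sub_eq_iff_eq_add] at hb
    rw [pow_succ, mul_assoc, hb, add_mul, mul_assoc]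

lemma IsCharElem.ne_zero {I : RightIdeal k} {f : A₁ k} (hf : IsCharElem I f) (hI : I ≠ ⊥) :
    f ≠ 0 := by
  rintro rfl
  obtain ⟨y, hy, hy0⟩ := (Submodule.ne_bot_iff I).mp hI
  let s : Set (A₁ k) := {y | y ∈ I ∧ y ≠ 0}
  have hs : s.Nonempty := ⟨y, hy, hy0⟩
  have hmem := Function.argminOn_mem tDegree s hs
  obtain ⟨c, -, hc⟩ := (hf.2 (Function.argminOn tDegree s hs)).mp
    (Or.inr ⟨hmem.1, fun z hz hz0 => Function.argminOn_le tDegree s (show z ∈ s from ⟨hz, hz0⟩)⟩)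
  exact hmem.2 (by rw [hc, zero_mul])

lemma aeval_del_mul_t (P : k[X]) :
    aeval (del k) P * t k - t k * aeval (del k) P = aeval (del k) (derivative P) := by
  induction P using Polynomial.induction_on' with
  | add P S hP hS => rw [map_add, map_add, map_add, ← hP, ← hS, add_mul, mul_add]; abel
  | monomial n a =>
    have key : ∀ n : ℕ, del k ^ n * t k - t k * del k ^ n = n • del k ^ (n - 1) := by
      intro n
      induction n with
      | zero => simp
      | succ n ih =>
        have h1 : del k * t k = t k * del k + 1 := by rw [← del_mul_t k]; abel
        rw [sub_eq_iff_eq_add] at ih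
        rw [pow_succ, mul_assoc, h1, mul_add, ← mul_assoc, ih, mul_one, add_mul]
        rcases n with _ | n
        · simp
        · rw [Nat.add_sub_cancel, Nat.add_sub_cancel, smul_mul_assoc, ← pow_succ,
            succ_nsmul (del k ^ (n + 1)) (n + 1), mul_assoc, ← pow_succ]
          abel
    rw [derivative_monomial, aeval_monomial, aeval_monomial, mul_assoc, ← mul_assoc (t k),
      ← Algebra.commutes, mul_assoc, ← mul_sub, key, map_mul, mul_assoc, map_natCast,
      nsmul_eq_mul]

variable [CharZero k]

/-- Pseudo-division on the right in a right ideal by an element of minimal `t`-degree. -/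
lemma exists_mul_eq_mul {I : RightIdeal k} {f : A₁ k} (hf : f ∈ I) (hf0 : f ≠ 0)
    (hmin : ∀ y ∈ I, y ≠ 0 → tDegree f ≤ tDegree y) {x : A₁ k} (hx : x ∈ I) :
    ∃ h ∈ polyDel k, h ≠ 0 ∧ ∃ a, x * h = f * a := by
  obtain ⟨n, hn⟩ := exists_ad_del_pow_eq_zero x
  induction n generalizing x with
  | zero =>
    have hx0 : x = 0 := by simpa using hn
    exact ⟨1, one_mem _, one_ne_zero, 0, by simp [hx0]⟩
  | succ n ih =>
    by_cases hx0 : x = 0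
    · exact ⟨1, one_mem _, one_ne_zero, 0, by simp [hx0]⟩
    have hle : tDegree f ≤ n := (hmin x hx hx0).trans (tDegree_le_iff.mpr hn)
    obtain ⟨m, rfl⟩ := Nat.exists_eq_add_of_le hle
    set α := (ad k (del k) ^ (tDegree f + m)) x with hα
    set β := (ad k (del k) ^ tDegree f) f with hβ
    have hαm : α ∈ polyDel k := ad_del_pow_mem_polyDel hn
    have hβm : β ∈ polyDel k := ad_del_pow_mem_polyDel (ad_del_pow_tDegree_succ f)
    have hβ0 : β ≠ 0 := ad_del_pow_tDegree_ne_zero hf0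
    -- Multiplying `f` by `t ^ m` brings it to the degree bound of `x`; `N` is the binomial
    -- coefficient from the Leibniz rule times `m!`.
    obtain ⟨N, hN0, hN⟩ : ∃ N : ℕ, N ≠ 0 ∧
        (ad k (del k) ^ (tDegree f + m)) (f * t k ^ m) = N • β := by
      refine ⟨(tDegree f + m).choose (tDegree f) * m.factorial, mul_ne_zero
        (Nat.choose_pos (Nat.le_add_right _ _)).ne' (Nat.factorial_ne_zero _), ?_⟩
      rw [ad_pow_mul_top _ _ _ _ _ (ad_del_pow_tDegree_succ f) (ad_del_pow_t_pow m).1,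
        (ad_del_pow_t_pow m).2, mul_smul_comm, mul_one, mul_smul]
    -- Cross-multiplying by the leading coefficients cancels the top terms, and the remainder stays
    -- in `I`, so minimality of `f` applies to it again.
    have hy : x * (N • β) - f * t k ^ m * α ∈ I :=
      I.sub_mem (mul_mem_of_mem hx _) (mul_mem_of_mem (mul_mem_of_mem hf _) _)
    have hy0 : (ad k (del k) ^ (tDegree f + m)) (x * (N • β) - f * t k ^ m * α) = 0 := by
      rw [map_sub, ad_pow_mul_of_commute (commute_del (nsmul_mem hβm N)),
        ad_pow_mul_of_commute (commute_del hαm), hN, ← hα,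
        (commute_of_mem_polyDel hαm (nsmul_mem hβm N)).eq, sub_self]
    obtain ⟨h, hh, hh0, a, ha⟩ := ih hy hy0
    refine ⟨(N • β) * h, mul_mem (nsmul_mem hβm N) hh,
      mul_ne_zero (smul_ne_zero hN0 hβ0) hh0, t k ^ m * α * h + a, ?_⟩
    rw [sub_mul, sub_eq_iff_eq_add] at ha
    rw [← mul_assoc, ha, mul_add, add_comm]
    simp only [mul_assoc]

lemma IsCharElem.le {I : RightIdeal k} {f : A₁ k} (hf : IsCharElem I f) :
    ∀ y ∈ I, y ≠ 0 → tDegree f ≤ tDegree y := by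
  rcases (hf.2 f).mpr ⟨1, one_mem _, (mul_one f).symm⟩ with h | h
  -- For `f = 0` the bound is trivial, because the degree of `0` takes the default value `0`.
  · rintro y hy hy0
    rw [h]
    have : tDegree (0 : A₁ k) = 0 := tDegree_eq_zero_iff.mpr (zero_mem _)
    omega
  · exact h.2

lemma IsCharElem.exists_eq {I : RightIdeal k} {f x : A₁ k} (hf : IsCharElem I f) (hx : x ∈ I)
    (h : tDegree x ≤ tDegree f) : ∃ c ∈ polyDel k, x = f * c :=
  (hf.2 x).mp (Or.inr ⟨hx, fun y hy hy0 => h.trans (hf.le y hy hy0)⟩)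

/-- The commutator with `t` differentiates `P(∂)`, so `P(∂) = 0` implies `P'(∂) = 0`, and induction
on the degree applies. -/
lemma aeval_del_injective : Function.Injective (aeval (del k) : k[X] →ₐ[k] A₁ k) := by
  rw [injective_iff_map_eq_zero]
  intro P
  induction hn : P.natDegree generalizing P with
  | zero =>
    intro h
    rw [eq_C_of_natDegree_eq_zero hn, aeval_C] at h
    rw [eq_C_of_natDegree_eq_zero hn,
      (map_eq_zero_iff _ (algebraMap k (A₁ k)).injective).mp h, C_0]
  | succ n ih =>
    intro h
    have h1 : aeval (del k) (derivative P) = 0 := by rw [← aeval_del_mul_t, h]; simp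
    have h2 := ih (derivative P) (by rw [natDegree_derivative, hn]; rfl) h1
    have := derivative_eq_zero.mp h2
    omega

lemma exists_algebraMap_eq_of_mul_eq_one {c d : A₁ k} (hc : c ∈ polyDel k) (hd : d ∈ polyDel k)
    (h : c * d = 1) : ∃ r : k, c = algebraMap k (A₁ k) r := by
  obtain ⟨P, rfl⟩ := mem_polyDel.mp hc
  obtain ⟨S, rfl⟩ := mem_polyDel.mp hd
  rw [← map_mul, ← map_one (aeval (del k) : k[X] →ₐ[k] A₁ k)] at h
  have h1 := aeval_del_injective h
  obtain ⟨r, -, hr⟩ := Polynomial.isUnit_iff.mp (IsUnit.of_mul_eq_one _ h1)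
  exact ⟨r, by rw [← hr, aeval_C]⟩

end Division

/-! ### Degrees in `Q₁` and minimal elements of the dual -/

section Fractions

variable {k : Type*} [Field k] [CharZero k]

lemma toQ_ne_zero {a : A₁ k} (h : a ≠ 0) : toQ k a ≠ 0 :=
  (map_ne_zero_iff _ (toQ_injective k)).mpr h

instance : CharZero (Q₁ k) :=
  charZero_of_injective_ringHom (toQ_injective k)

/-- Inner derivations of `Q₁` are taken over `ℤ`, as no `k`-algebra structure is put on `Q₁`. -/
lemma ad_toQ_pow (p : A₁ k) (n : ℕ) (a : A₁ k) :
    (ad ℤ (toQ k p) ^ n) (toQ k a) = toQ k ((ad k p ^ n) a) := by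
  induction n generalizing a with
  | zero => rfl
  | succ n ih =>
    rw [pow_succ, pow_succ, Module.End.mul_apply, Module.End.mul_apply, ← ih, ad_apply, ad_apply,
      map_sub (toQ k), map_mul, map_mul]

lemma HasTDegree.add_tDegree {u : Q₁ k} {m : ℤ} (hu : HasTDegree u m) {f d : A₁ k} (hf : f ≠ 0)
    (hd : d ≠ 0) (h : u * toQ k f = toQ k d) : m + tDegree f = tDegree d := by
  obtain ⟨a, b, ha, hb, rfl, rfl⟩ := hu
  rw [mul_assoc, inv_mul_eq_iff_eq_mul₀ (toQ_ne_zero hb), ← map_mul, ← map_mul] at h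
  have h1 := congrArg tDegree (toQ_injective k h)
  rw [tDegree_mul ha hf, tDegree_mul hb hd] at h1
  omega

lemma exists_hasTDegree {u : Q₁ k} (hu : u ≠ 0) : ∃ m, HasTDegree u m := by
  obtain ⟨a, b, hb, rfl⟩ := exists_eq_inv_mul u
  refine ⟨_, a, b, ?_, hb, rfl, rfl⟩
  rintro rfl
  simp at hu

/-- Right multiplication by an element commuting with `∂` does not raise the nilpotency order, so `f
c` has at most the degree of `f` and must lie in `f k[∂]`. -/
lemma mem_polyDel_of_toQ {I : RightIdeal k} {f : A₁ k} (hf : IsCharElem I f) (hf0 : f ≠ 0)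
    {c : Q₁ k} (hc : Commute (toQ k (del k)) c) {x : A₁ k} (hx : x ∈ I)
    (h : toQ k f * c = toQ k x) : ∃ d ∈ polyDel k, c = toQ k d := by
  have h1 : (ad k (del k) ^ (tDegree f + 1)) x = 0 := by
    apply toQ_injective k
    rw [← ad_toQ_pow, ← h, ad_pow_mul_of_commute hc, ad_toQ_pow, ad_del_pow_tDegree_succ]
    simp
  obtain ⟨d, hd, rfl⟩ := hf.exists_eq hx (tDegree_le_iff.mpr h1)
  rw [map_mul] at h
  exact ⟨d, hd, mul_left_cancel₀ (toQ_ne_zero hf0) h⟩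

/-- An element `u` of the dual with `u f` in `k[∂]` has minimal `t`-degree. -/
lemma hasTDegree_le_of_mem_dual {I : RightIdeal k} {f : A₁ k} (hf : f ∈ I) (hf0 : f ≠ 0)
    {u : Q₁ k} {g : A₁ k} (hg : g ∈ polyDel k) (hg0 : g ≠ 0) (hug : u * toQ k f = toQ k g)
    {n : ℤ} (hn : HasTDegree u n) :
    ∀ y ∈ dual I, y ≠ 0 → ∀ m, HasTDegree y m → n ≤ m := by
  intro y hy hy0 m hm
  have h1 := hn.add_tDegree hf0 hg0 hug
  obtain ⟨d, hd⟩ := hy f hf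
  have hd0 : d ≠ 0 := by
    rintro rfl
    rw [map_zero] at hd
    exact (mul_ne_zero hy0 (toQ_ne_zero hf0)) hd
  have h2 := hm.add_tDegree hf0 hd0 hd
  rw [tDegree_eq_zero_iff.mpr hg] at h1
  omega

lemma IsDualCharElem.exists_eq {I : RightIdeal k} {f : A₁ k} (hf : f ∈ I) (hf0 : f ≠ 0) {e : Q₁ k}
    (he : IsDualCharElem I e) {u : Q₁ k} (hu : u ∈ dual I) {g : A₁ k} (hg : g ∈ polyDel k)
    (hg0 : g ≠ 0) (hug : u * toQ k f = toQ k g) : ∃ c ∈ polyDel k, u = toQ k c * e := by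
  have hu0 : u ≠ 0 := by
    rintro rfl
    rw [zero_mul] at hug
    exact toQ_ne_zero hg0 hug.symm
  obtain ⟨n, hn⟩ := exists_hasTDegree hu0
  exact (he.2 u).mp (Or.inr ⟨hu, n, hn, hasTDegree_le_of_mem_dual hf hf0 hg hg0 hug hn⟩)

end Fractions

/-! ### The product `e f` lies in `k[∂]` -/

section Noetherian

variable {k : Type*} [Field k]

/-- The ideal of leading coefficients of the elements of a right ideal of `t`-degree at most `n`. -/
noncomputable def leadingIdeal (I : RightIdeal k) (n : ℕ) : Ideal k[X] where
  carrier := {P | ∃ x ∈ I, (ad k (del k) ^ (n + 1)) x = 0 ∧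
    (ad k (del k) ^ n) x = aeval (del k) P}
  zero_mem' := ⟨0, I.zero_mem, by simp, by simp⟩
  add_mem' := by
    rintro P S ⟨x, hx, hx0, hP⟩ ⟨y, hy, hy0, hS⟩
    exact ⟨x + y, I.add_mem hx hy, by rw [map_add, hx0, hy0, add_zero],
      by rw [map_add, hP, hS, map_add]⟩
  smul_mem' := by
    rintro P S ⟨x, hx, hx0, hS⟩
    have hc := commute_del (aeval_del_mem (k := k) P)
    refine ⟨x * aeval (del k) P, mul_mem_of_mem hx _, ?_, ?_⟩
    · rw [ad_pow_mul_of_commute hc, hx0, zero_mul]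
    · rw [ad_pow_mul_of_commute hc, hS, ← map_mul, smul_eq_mul, mul_comm]

lemma mem_leadingIdeal {I : RightIdeal k} {n : ℕ} {P : k[X]} : P ∈ leadingIdeal I n ↔
    ∃ x ∈ I, (ad k (del k) ^ (n + 1)) x = 0 ∧ (ad k (del k) ^ n) x = aeval (del k) P := Iff.rfl

lemma ad_del_pow_mul_t {n : ℕ} {x : A₁ k} (hx : (ad k (del k) ^ (n + 1)) x = 0) :
    (ad k (del k) ^ (n + 2)) (x * t k) = 0 ∧
      (ad k (del k) ^ (n + 1)) (x * t k) = (n + 1) • (ad k (del k) ^ n) x := by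
  have h := ad_del_pow_t_pow (k := k) 1
  rw [pow_one (t k)] at h
  refine ⟨ad_pow_succ_mul_eq_zero _ _ _ _ _ hx h.1, ?_⟩
  rw [ad_pow_mul_top _ _ _ _ _ hx h.1, h.2]
  simp

variable [CharZero k]

lemma leadingIdeal_mono (I : RightIdeal k) : Monotone (leadingIdeal I) := by
  refine monotone_nat_of_le_succ fun n P hP => ?_
  obtain ⟨x, hx, hx0, hP⟩ := mem_leadingIdeal.mp hP
  obtain ⟨h1, h2⟩ := ad_del_pow_mul_t hx0
  have h3 : (n + 1) • P ∈ leadingIdeal I (n + 1) :=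
    mem_leadingIdeal.mpr ⟨x * t k, mul_mem_of_mem hx _, h1, by rw [h2, hP, map_nsmul]⟩
  have h4 := (leadingIdeal I (n + 1)).mul_mem_left (C ((n + 1 : k)⁻¹)) h3
  have h5 : (n + 1 : k) ≠ 0 := Nat.cast_add_one_ne_zero n
  convert h4 using 1
  rw [nsmul_eq_mul, ← mul_assoc, Nat.cast_add, Nat.cast_one, ← C_1, ← map_natCast C, ← C_add,
    ← C_mul, inv_mul_cancel₀ h5, C_1, one_mul]

/-- The elements of `I`, divided on the left by a non-zero `f ∈ I` of minimal `t`-degree, have a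
common left denominator in `k[∂]`. -/
lemma exists_common_denominator {I : RightIdeal k} {f : A₁ k} (hf : f ∈ I) (hf0 : f ≠ 0)
    (hmin : ∀ y ∈ I, y ≠ 0 → tDegree f ≤ tDegree y) :
    ∃ g ∈ polyDel k, g ≠ 0 ∧ toQ k g * (toQ k f)⁻¹ ∈ dual I := by
  have hQf := toQ_ne_zero hf0
  -- For a single `x`, pseudo-division gives `f⁻¹ x = a h⁻¹`, and a power of `h` on the left clears
  -- this denominator.
  have hsingle : ∀ x ∈ I, ∃ g ∈ polyDel k, g ≠ 0 ∧
      ∃ b, toQ k g * (toQ k f)⁻¹ * toQ k x = toQ k b := by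
    intro x hx
    obtain ⟨h, hh, hh0, a, ha⟩ := exists_mul_eq_mul hf hf0 hmin hx
    obtain ⟨n, hn⟩ := exists_ad_del_pow_eq_zero a
    obtain ⟨b, hb⟩ := exists_pow_mul_eq hh hn
    refine ⟨h ^ n, pow_mem hh n, pow_ne_zero n hh0, b, ?_⟩
    apply mul_right_cancel₀ (toQ_ne_zero hh0)
    rw [← map_mul, ← hb, mul_assoc, ← map_mul, ha, map_mul, map_mul, mul_assoc,
      inv_mul_cancel_left₀ hQf]
  -- Leading coefficient ideals increase with the degree because `I` is stable under right
  -- multiplication by `t`; Noetherianity of `k[X]` bounds the number of denominators needed.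
  obtain ⟨N, hN⟩ := monotone_stabilizes_iff_noetherian.mpr
    (inferInstance : IsNoetherian k[X] k[X]) ⟨leadingIdeal I, leadingIdeal_mono I⟩
  have hfinite : ∀ n, ∃ g ∈ polyDel k, g ≠ 0 ∧ ∀ x ∈ I, (ad k (del k) ^ n) x = 0 →
      ∃ b, toQ k g * (toQ k f)⁻¹ * toQ k x = toQ k b := by
    intro n
    induction n with
    | zero =>
      refine ⟨1, one_mem _, one_ne_zero, fun x hx h => ⟨0, ?_⟩⟩
      have : x = 0 := by simpa using h
      simp [this]
    | succ n ih =>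
      obtain ⟨g, hg, hg0, hgx⟩ := ih
      -- One element `y` of `I`, whose leading coefficient generates the ideal, accounts for all
      -- leading terms in degree `n`; only its denominator is new.
      obtain ⟨G, hG⟩ := (IsPrincipalIdealRing.principal (leadingIdeal I n)).principal
      have hGm : G ∈ leadingIdeal I n := by rw [hG]; exact Submodule.mem_span_singleton_self G
      obtain ⟨y, hy, hy0, hyG⟩ := mem_leadingIdeal.mp hGm
      obtain ⟨h, hh, hh0, b, hb⟩ := hsingle y hy
      refine ⟨h * g, mul_mem hh hg, mul_ne_zero hh0 hg0, fun x hx hxn => ?_⟩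
      obtain ⟨P, hP⟩ := mem_polyDel.mp (ad_del_pow_mem_polyDel hxn)
      have hPm : P ∈ leadingIdeal I n := mem_leadingIdeal.mpr ⟨x, hx, hxn, hP⟩
      rw [hG] at hPm
      obtain ⟨S, rfl⟩ := Ideal.mem_span_singleton'.mp hPm
      have hc := commute_del (aeval_del_mem (k := k) S)
      obtain ⟨b', hb'⟩ := hgx (x - y * aeval (del k) S) (I.sub_mem hx (mul_mem_of_mem hy _)) (by
        rw [map_sub, ad_pow_mul_of_commute hc, hyG, hP, ← map_mul, mul_comm, sub_self])
      refine ⟨h * b' + g * b * aeval (del k) S, ?_⟩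
      have e1 : toQ k x = toQ k (x - y * aeval (del k) S) + toQ k y * toQ k (aeval (del k) S) := by
        rw [← map_mul, ← map_add, sub_add_cancel]
      have e2 : toQ k (h * g) = toQ k (g * h) := by rw [(commute_of_mem_polyDel hh hg).eq]
      rw [e1, mul_add, map_add, map_mul _ h b', ← hb', map_mul _ (g * b), map_mul _ g b, ← hb]
      congr 1
      · rw [map_mul]; simp only [mul_assoc]
      · rw [e2, map_mul]; simp only [mul_assoc]
  obtain ⟨g, hg, hg0, hgx⟩ := hfinite (N + 1)
  refine ⟨g, hg, hg0, ?_⟩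
  -- Beyond degree `N` every leading term already comes from some `y * t` with `y ∈ I` of smaller
  -- degree, so `g` needs no further factor.
  have hall : ∀ n, ∀ x ∈ I, (ad k (del k) ^ (N + 1 + n)) x = 0 →
      ∃ b, toQ k g * (toQ k f)⁻¹ * toQ k x = toQ k b := by
    intro n
    induction n with
    | zero => exact hgx
    | succ n ih =>
      intro x hx hxn
      obtain ⟨P, hP⟩ := mem_polyDel.mp (ad_del_pow_mem_polyDel (n := N + 1 + n) hxn)
      have hPm : P ∈ leadingIdeal I (N + 1 + n) := mem_leadingIdeal.mpr ⟨x, hx, hxn, hP⟩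
      have e : leadingIdeal I (N + 1 + n) = leadingIdeal I (N + n) :=
        (hN (N + 1 + n) (by omega)).symm.trans (hN (N + n) (by omega))
      rw [e] at hPm
      obtain ⟨y, hy, hy0, hyP⟩ := mem_leadingIdeal.mp hPm
      obtain ⟨h1, h2⟩ := ad_del_pow_mul_t hy0
      set r : k := (N + n + 1 : k)⁻¹ with hr
      have hr1 : (N + n + 1 : k) * r = 1 := by
        rw [hr, mul_inv_cancel₀]; exact_mod_cast (Nat.succ_ne_zero (N + n))
      obtain ⟨b, hb⟩ := ih y hy (by rwa [show N + 1 + n = N + n + 1 by omega])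
      have hz : (ad k (del k) ^ (N + 1 + n)) (x - r • (y * t k)) = 0 := by
        rw [map_sub, map_smul, hP, show N + 1 + n = N + n + 1 by omega, h2, hyP,
          ← Nat.cast_smul_eq_nsmul k, smul_smul, mul_comm]
        push_cast
        rw [hr1, one_smul, sub_self]
      have hsm : r • (y * t k) = y * (r • t k) := by rw [mul_smul_comm]
      rw [hsm] at hz
      obtain ⟨b', hb'⟩ := ih _ (I.sub_mem hx (mul_mem_of_mem hy _)) hz
      refine ⟨b' + b * (r • t k), ?_⟩
      rw [map_add, map_mul, ← hb', ← hb, mul_assoc _ (toQ k y), ← map_mul, ← mul_add, ← map_add,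
        sub_add_cancel]
  intro x hx
  obtain ⟨n, hn⟩ := exists_ad_del_pow_eq_zero x
  exact hall n x hx (ad_pow_eq_zero_of_le (by omega) hn)

/-- The common denominator `g` gives `g f⁻¹` in the dual, of degree `-deg f`. By minimality `e` has
at most this degree, so `e f ∈ A₁` has degree zero. -/
lemma exists_polyDel_eq_mul {I : RightIdeal k} {f : A₁ k} (hf : IsCharElem I f) (hf0 : f ≠ 0)
    {e : Q₁ k} (he : IsDualCharElem I e) : ∃ v ∈ polyDel k, e * toQ k f = toQ k v := by
  obtain ⟨g, hg, hg0, hgI⟩ := exists_common_denominator hf.1 hf0 hf.le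
  have hge : toQ k g * (toQ k f)⁻¹ * toQ k f = toQ k g := by
    rw [mul_assoc, inv_mul_cancel₀ (toQ_ne_zero hf0), mul_one]
  have hu0 : toQ k g * (toQ k f)⁻¹ ≠ 0 :=
    mul_ne_zero (toQ_ne_zero hg0) (inv_ne_zero (toQ_ne_zero hf0))
  obtain ⟨v, hv⟩ := he.1 f hf.1
  refine ⟨v, ?_, hv⟩
  rcases (he.2 e).mpr ⟨1, one_mem _, by rw [map_one, one_mul]⟩ with rfl | ⟨-, n, hn, hmin⟩
  · rw [zero_mul, eq_comm, map_eq_zero_iff _ (toQ_injective k)] at hv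
    rw [hv]; exact zero_mem _
  · by_cases hv0 : v = 0
    · rw [hv0]; exact zero_mem _
    obtain ⟨m, hm⟩ := exists_hasTDegree hu0
    have h1 := hmin _ hgI hu0 m hm
    have h2 := hm.add_tDegree hf0 hg0 hge
    have h3 := hn.add_tDegree hf0 hv0 hv
    rw [tDegree_eq_zero_iff.mpr hg] at h2
    exact tDegree_eq_zero_iff.mp (by omega)

end Noetherian
-- The automorphisms `exp (ad P(∂))`
section Exponential

variable {k : Type*} [Field k]

lemma algHom_ext_of_t_del {σ τ : A₁ k →ₐ[k] A₁ k} (ht : σ (t k) = τ (t k))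
    (hd : σ (del k) = τ (del k)) : σ = τ := by
  refine AlgHom.ext fun x => ?_
  obtain ⟨n, hn⟩ := exists_mem_tDegreeLE x
  induction hn using Submodule.span_induction with
  | mem x hx =>
    obtain ⟨i, j, -, rfl⟩ := hx
    rw [map_mul, map_mul, map_pow, map_pow, map_pow, map_pow, ht, hd]
  | zero => rw [map_zero, map_zero]
  | add x y _ _ hx hy => rw [map_add, map_add, hx, hy]
  | smul r x _ hx => rw [map_smul, map_smul, hx]

variable [CharZero k]

lemma ad_pow_eq_zero_of_ad_del_pow {p : A₁ k} (hp : p ∈ polyDel k) {n : ℕ} {a : A₁ k}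
    (ha : (ad k (del k) ^ n) a = 0) : (ad k p ^ n) a = 0 := by
  induction n generalizing a with
  | zero => exact ha
  | succ n ih =>
    rw [pow_succ, Module.End.mul_apply]
    refine ih ?_
    rw [ad_pow_comm (commute_del hp)]
    exact ad_eq_zero (commute_of_mem_polyDel hp (ad_del_pow_mem_polyDel ha))

lemma exists_ad_pow_eq_zero (P : k[X]) (a : A₁ k) : ∃ n, (ad k (aeval (del k) P) ^ n) a = 0 :=
  (exists_ad_del_pow_eq_zero a).imp fun _ h => ad_pow_eq_zero_of_ad_del_pow (aeval_del_mem P) h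

/-- The polynomial `∑ i, (ad p) ^ i a / i! X ^ i`, where `p = P(∂)`. -/
noncomputable def expPoly (P : k[X]) (a : A₁ k) : (A₁ k)[X] :=
  ∑ i ∈ Finset.range (exists_ad_pow_eq_zero P a).choose,
    monomial i ((i.factorial : k)⁻¹ • (ad k (aeval (del k) P) ^ i) a)

/-- The chosen truncation bound disappears from the coefficients, so additivity and multiplicativity
can be checked coefficientwise. -/
lemma coeff_expPoly (P : k[X]) (a : A₁ k) (n : ℕ) :
    (expPoly P a).coeff n = (n.factorial : k)⁻¹ • (ad k (aeval (del k) P) ^ n) a := by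
  rw [expPoly, finsetSum_coeff]
  simp only [coeff_monomial]
  rw [Finset.sum_ite_eq' (Finset.range _) n]
  split_ifs with h
  · rfl
  · rw [ad_pow_eq_zero_of_le (not_lt.mp (mt Finset.mem_range.mpr h))
      (exists_ad_pow_eq_zero P a).choose_spec, smul_zero]

lemma expPoly_add (P : k[X]) (a b : A₁ k) : expPoly P (a + b) = expPoly P a + expPoly P b := by
  ext n
  rw [coeff_add, coeff_expPoly, coeff_expPoly, coeff_expPoly, map_add, smul_add]

lemma expPoly_mul (P : k[X]) (a b : A₁ k) : expPoly P (a * b) = expPoly P a * expPoly P b := by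
  ext n
  rw [coeff_mul, coeff_expPoly, ad_pow_mul, Finset.smul_sum]
  refine Finset.sum_congr rfl fun ij hij => ?_
  have hn := Finset.HasAntidiagonal.mem_antidiagonal.mp hij
  have h0 (m : ℕ) : (m.factorial : k) ≠ 0 := Nat.cast_ne_zero.mpr m.factorial_ne_zero
  have hc : (n.choose ij.1 : k) * (ij.1.factorial : k) * (ij.2.factorial : k) = n.factorial := by
    have h := Nat.choose_mul_factorial_mul_factorial (show ij.1 ≤ n by omega)
    rw [show n - ij.1 = ij.2 by omega] at h
    exact_mod_cast h
  rw [coeff_expPoly, coeff_expPoly, smul_mul_smul_comm, ← Nat.cast_smul_eq_nsmul k, smul_smul]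
  congr 1
  rw [← hc]
  have h3 : (n.choose ij.1 : k) ≠ 0 := fun h => h0 n (by rw [← hc, h]; simp)
  have h1 := h0 ij.1
  have h2 := h0 ij.2
  field_simp

lemma expPoly_algebraMap (P : k[X]) (r : k) :
    expPoly P (algebraMap k (A₁ k) r) = C (algebraMap k (A₁ k) r) := by
  ext n
  rw [coeff_expPoly, coeff_C]
  rcases n with _ | n
  · simp
  · rw [pow_succ, Module.End.mul_apply, ad_eq_zero (Algebra.commutes r _).symm]
    simp

/-- The endomorphism `exp (ad p)` of `A₁` for `p = P(∂)`. -/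
noncomputable def expHom (P : k[X]) : A₁ k →ₐ[k] A₁ k where
  toFun a := (expPoly P a).eval 1
  map_one' := by
    have h := expPoly_algebraMap P 1
    rw [map_one] at h
    rw [h, eval_C]
  map_mul' a b := by
    rw [expPoly_mul]
    exact eval₂_mul_noncomm _ _ fun _ => Commute.one_right _
  map_zero' := by
    have h := expPoly_algebraMap P 0
    rw [map_zero] at h
    rw [h, eval_C]
  map_add' a b := by rw [expPoly_add, eval_add]
  commutes' r := by rw [expPoly_algebraMap, eval_C]

lemma expHom_apply (P : k[X]) {a : A₁ k} {N : ℕ} (h : (ad k (aeval (del k) P) ^ N) a = 0) :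
    expHom P a = ∑ i ∈ Finset.range N,
      (i.factorial : k)⁻¹ • (ad k (aeval (del k) P) ^ i) a := by
  change (expPoly P a).eval 1 = _
  have hlt : (expPoly P a).natDegree < N + 1 := by
    refine Nat.lt_succ_of_le (natDegree_le_iff_coeff_eq_zero.mpr fun m hm => ?_)
    rw [coeff_expPoly, ad_pow_eq_zero_of_le hm.le h, smul_zero]
  rw [eval_eq_sum_range' hlt, Finset.sum_range_succ, coeff_expPoly, h, smul_zero, zero_mul,
    add_zero]
  exact Finset.sum_congr rfl fun i _ => by rw [one_pow, mul_one, coeff_expPoly]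

lemma expHom_of_mem (P : k[X]) {c : A₁ k} (hc : c ∈ polyDel k) : expHom P c = c := by
  rw [expHom_apply P (N := 1)]
  · simp
  · rw [pow_one]; exact ad_eq_zero (commute_of_mem_polyDel (aeval_del_mem P) hc)

lemma expHom_t (P : k[X]) : expHom P (t k) = t k + aeval (del k) (derivative P) := by
  rw [expHom_apply P (N := 2)]
  · simp [Finset.sum_range_succ, ad_apply, aeval_del_mul_t]
  · rw [pow_succ, pow_one, Module.End.mul_apply, ad_apply _ _ (t k), aeval_del_mul_t]
    exact ad_eq_zero (commute_of_mem_polyDel (aeval_del_mem P) (aeval_del_mem _))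

lemma expHom_comp_neg (P : k[X]) : (expHom P).comp (expHom (-P)) = AlgHom.id k (A₁ k) := by
  refine algHom_ext_of_t_del ?_ ?_
  · rw [AlgHom.comp_apply, expHom_t, map_add, expHom_t, expHom_of_mem P (aeval_del_mem _),
      derivative_neg, map_neg, add_neg_cancel_right]
    rfl
  · rw [AlgHom.comp_apply, expHom_of_mem _ del_mem_polyDel, expHom_of_mem _ del_mem_polyDel]
    rfl

/-- The automorphism `exp (ad p)` of `A₁` for `p = P(∂)`. -/
noncomputable def expAut (P : k[X]) : A₁ k ≃ₐ[k] A₁ k :=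
  AlgEquiv.ofAlgHom (expHom P) (expHom (-P)) (expHom_comp_neg P) (by
    have h := expHom_comp_neg (-P)
    rwa [neg_neg] at h)

lemma expAut_apply (P : k[X]) (a : A₁ k) : expAut P a = expHom P a := rfl

lemma expAut_symm_apply (P : k[X]) (a : A₁ k) : (expAut P).symm a = expHom (-P) a := rfl

end Exponential

/-! ### Stability of `f⁻¹ I` and the Stafford subgroup -/

section Quotients

variable {k : Type*} [Field k]

/-- The elements `a` such that `f a` lies in `I h`. -/
def quotientSubmodule (I : RightIdeal k) (f h : A₁ k) : Submodule k (A₁ k) where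
  carrier := {a | ∃ x ∈ I, f * a = x * h}
  zero_mem' := ⟨0, I.zero_mem, by simp⟩
  add_mem' := by
    rintro a b ⟨x, hx, ha⟩ ⟨y, hy, hb⟩
    exact ⟨x + y, I.add_mem hx hy, by rw [mul_add, ha, hb, add_mul]⟩
  smul_mem' := by
    rintro r a ⟨x, hx, ha⟩
    refine ⟨x * algebraMap k (A₁ k) r, mul_mem_of_mem hx _, ?_⟩
    rw [mul_smul_comm, ha, Algebra.smul_def, Algebra.commutes, mul_assoc, mul_assoc,
      Algebra.commutes]

lemma mul_mem_quotientSubmodule {I : RightIdeal k} {f h a c : A₁ k} (hc : Commute c h)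
    (ha : a ∈ quotientSubmodule I f h) : a * c ∈ quotientSubmodule I f h := by
  obtain ⟨x, hx, e⟩ := ha
  exact ⟨x * c, mul_mem_of_mem hx _, by rw [← mul_assoc, e, mul_assoc, mul_assoc, hc.eq]⟩

/-- Right multiplication by `p` always preserves the numerators when `p` commutes with `h`, so
stability under `ad p` and under left multiplication by `p` amount to the same. -/
lemma ad_mem_quotientSubmodule_iff {I : RightIdeal k} {f h a p : A₁ k} (hp : Commute p h)
    (ha : a ∈ quotientSubmodule I f h) :
    ad k p a ∈ quotientSubmodule I f h ↔ p * a ∈ quotientSubmodule I f h := by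
  rw [ad_apply]
  exact Submodule.sub_mem_iff_left _ (mul_mem_quotientSubmodule hp ha)

/-- An isomorphism `σ(I) ≅ I` as a `σ`-semilinear bijection of `I`. -/
lemma exists_semilinear_of_mem_stafford {I : RightIdeal k} {σ : A₁ k ≃ₐ[k] A₁ k}
    (hσ : σ ∈ stafford I) : ∃ ψ : A₁ k → A₁ k, (∀ x ∈ I, ψ x ∈ I) ∧
      (∀ x ∈ I, ∀ a, ψ (x * a) = ψ x * σ a) ∧ (∀ x ∈ I, ψ x = 0 → x = 0) ∧
      ∀ y ∈ I, ∃ x ∈ I, ψ x = y := by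
  classical
  obtain ⟨φ⟩ := hσ
  have hmem : ∀ x ∈ I, σ x ∈ RightIdeal.image σ I := fun x hx => ⟨x, hx, rfl⟩
  let ψ : A₁ k → A₁ k := fun x => if hx : x ∈ I then (φ ⟨σ x, hmem x hx⟩ : I).1 else 0
  have hψ : ∀ x (hx : x ∈ I), ψ x = (φ ⟨σ x, hmem x hx⟩ : I).1 := fun x hx => dif_pos hx
  refine ⟨ψ, fun x hx => ?_, fun x hx a => ?_, fun x hx h => ?_, fun y hy => ?_⟩
  · rw [hψ x hx]; exact (φ _).2
  · rw [hψ x hx, hψ _ (mul_mem_of_mem hx a)]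
    have h1 : (⟨σ (x * a), hmem _ (mul_mem_of_mem hx a)⟩ : RightIdeal.image σ I) =
        MulOpposite.op (σ a) • ⟨σ x, hmem x hx⟩ := Subtype.ext (map_mul σ x a)
    rw [h1, map_smul]
    rfl
  · rw [hψ x hx] at h
    have h1 := (map_eq_zero_iff φ φ.injective).mp (Subtype.ext h : φ ⟨σ x, hmem x hx⟩ = 0)
    exact (map_eq_zero_iff σ σ.injective).mp (congrArg Subtype.val h1)
  · obtain ⟨x, hx, e⟩ := (φ.symm ⟨y, hy⟩).2
    refine ⟨x, hx, ?_⟩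
    rw [hψ x hx]
    have h1 : (⟨σ x, hmem x hx⟩ : RightIdeal.image σ I) = φ.symm ⟨y, hy⟩ := Subtype.ext e
    rw [h1, LinearEquiv.apply_symm_apply]

variable [CharZero k]

lemma expHom_mem_quotientSubmodule {I : RightIdeal k} {f h : A₁ k} (hh : h ∈ polyDel k) {P : k[X]}
    (hP : ∀ a ∈ quotientSubmodule I f h, aeval (del k) P * a ∈ quotientSubmodule I f h)
    {a : A₁ k} (ha : a ∈ quotientSubmodule I f h) : expHom P a ∈ quotientSubmodule I f h := by
  obtain ⟨N, hN⟩ := exists_ad_pow_eq_zero P a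
  rw [expHom_apply P hN]
  refine Submodule.sum_mem _ fun i hi => Submodule.smul_mem _ _ ?_
  clear hi
  induction i with
  | zero => exact ha
  | succ i ih =>
    rw [pow_succ', Module.End.mul_apply, ad_mem_quotientSubmodule_iff
      (commute_of_mem_polyDel (aeval_del_mem P) hh) ih]
    exact hP _ ih

lemma nonempty_linearEquiv {I J : RightIdeal k} {q : Q₁ k} (hq : q ≠ 0)
    (h1 : ∀ z ∈ J, ∃ y ∈ I, toQ k y = q * toQ k z) (h2 : ∀ y ∈ I, ∃ z ∈ J, toQ k y = q * toQ k z) :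
    Nonempty (J ≃ₗ[(A₁ k)ᵐᵒᵖ] I) := by
  choose! φ hφ hφq using h1
  let ψ : J →ₗ[(A₁ k)ᵐᵒᵖ] I :=
    { toFun := fun z => ⟨φ z, hφ z z.2⟩
      map_add' := fun z w => Subtype.ext (toQ_injective k (by
        change toQ k (φ (z.1 + w.1)) = toQ k (φ z.1 + φ w.1)
        rw [hφq _ (J.add_mem z.2 w.2), map_add, map_add, hφq _ z.2, hφq _ w.2, mul_add]))
      map_smul' := fun c z => Subtype.ext (toQ_injective k (by
        change toQ k (φ (z.1 * c.unop)) = toQ k (φ z.1 * c.unop)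
        rw [hφq _ (mul_mem_of_mem z.2 _), map_mul, map_mul, hφq _ z.2, mul_assoc])) }
  refine ⟨LinearEquiv.ofBijective ψ ⟨fun z w hzw => ?_, fun y => ?_⟩⟩
  · have h : toQ k (φ z.1) = toQ k (φ w.1) := congrArg (fun y : I => toQ k y.1) hzw
    rw [hφq _ z.2, hφq _ w.2] at h
    exact Subtype.ext (toQ_injective k (mul_left_cancel₀ hq h))
  · obtain ⟨z, hz, h⟩ := h2 y.1 y.2
    exact ⟨⟨z, hz⟩, Subtype.ext (toQ_injective k ((hφq z hz).trans h.symm))⟩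

lemma expAut_mem_stafford {I : RightIdeal k} {f : A₁ k} (hf : f ∈ I) (hf0 : f ≠ 0)
    (hmin : ∀ y ∈ I, y ≠ 0 → tDegree f ≤ tDegree y) {P : k[X]}
    (hP : ∀ h ∈ polyDel k, ∀ a ∈ quotientSubmodule I f h,
      aeval (del k) P * a ∈ quotientSubmodule I f h) : expAut P ∈ stafford I := by
  have hσf : expAut P f ≠ 0 := (map_ne_zero_iff _ (expAut P).injective).mpr hf0
  have hQ := toQ_ne_zero hσf
  have hQf := toQ_ne_zero hf0
  -- Writing `σ` for `expAut P`: since `σ` fixes `h`, applying it to `x = f a h⁻¹` gives `σ(x) =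
  -- σ(f) σ(a) h⁻¹`, whence `y = f σ(a) h⁻¹ = f σ(f)⁻¹ σ(x)`.
  have key : ∀ {h x a y : A₁ k}, h ∈ polyDel k → h ≠ 0 → x * h = f * a →
      f * expAut P a = y * h →
      toQ k y = toQ k f * (toQ k (expAut P f))⁻¹ * toQ k (expAut P x) := by
    intro h x a y hh hh0 e1 e2
    have e3 := congrArg (expAut P) e1
    rw [map_mul, map_mul, expAut_apply P h, expHom_of_mem P hh] at e3
    apply mul_right_cancel₀ (toQ_ne_zero hh0)
    rw [← map_mul, ← e2, mul_assoc _ (toQ k (expAut P x)), ← map_mul (toQ k) (expAut P x), e3,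
      map_mul, map_mul, mul_assoc, inv_mul_cancel_left₀ hQ]
  refine nonempty_linearEquiv (q := toQ k f * (toQ k (expAut P f))⁻¹)
    (mul_ne_zero hQf (inv_ne_zero hQ)) ?_ ?_
  · rintro _ ⟨x, hx, rfl⟩
    obtain ⟨h, hh, hh0, a, ha⟩ := exists_mul_eq_mul hf hf0 hmin hx
    obtain ⟨y, hy, e⟩ := expHom_mem_quotientSubmodule hh (hP h hh) ⟨x, hx, ha.symm⟩
    exact ⟨y, hy, key hh hh0 ha e⟩
  · intro y hy
    obtain ⟨h, hh, hh0, a, ha⟩ := exists_mul_eq_mul hf hf0 hmin hy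
    have hnP : ∀ a ∈ quotientSubmodule I f h, aeval (del k) (-P) * a ∈ quotientSubmodule I f h := by
      intro a ha
      rw [map_neg, neg_mul]
      exact Submodule.neg_mem _ (hP h hh a ha)
    obtain ⟨x, hx, e⟩ := expHom_mem_quotientSubmodule hh hnP ⟨y, hy, ha.symm⟩
    refine ⟨expAut P x, ⟨x, hx, rfl⟩, key hh hh0 e.symm ?_⟩
    rw [← expAut_symm_apply, AlgEquiv.apply_symm_apply, ha]

lemma tDegree_apply {σ : A₁ k ≃ₐ[k] A₁ k} (hσ : σ (del k) = del k) (a : A₁ k) :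
    tDegree (σ a) = tDegree a := by
  have key : ∀ n, (ad k (del k) ^ n) (σ a) = σ ((ad k (del k) ^ n) a) := by
    intro n
    induction n with
    | zero => rfl
    | succ n ih =>
      rw [pow_succ', Module.End.mul_apply, Module.End.mul_apply, ih, ad_apply, ad_apply, map_sub σ,
        map_mul, map_mul, hσ]
  refine eq_of_forall_ge_iff fun n => ?_
  rw [tDegree_le_iff, tDegree_le_iff, key, map_eq_zero_iff σ σ.injective]

/-- A `σ`-semilinear bijection `ψ` of `I` must multiply `f` by a non-zero scalar. Applying `ψ` to `f
a = x h` then shows that `σ` preserves the numerators. -/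
lemma apply_mem_quotientSubmodule {I : RightIdeal k} {f : A₁ k} (hf : IsCharElem I f)
    (hf0 : f ≠ 0) {σ : A₁ k ≃ₐ[k] A₁ k} (hσ : ∀ c ∈ polyDel k, σ c = c) (hσI : σ ∈ stafford I)
    {h a : A₁ k} (hh : h ∈ polyDel k) (ha : a ∈ quotientSubmodule I f h) :
    σ a ∈ quotientSubmodule I f h := by
  obtain ⟨ψ, hψI, hψm, hψ0, hψs⟩ := exists_semilinear_of_mem_stafford hσI
  have hψf0 : ψ f ≠ 0 := fun h => hf0 (hψ0 f hf.1 h)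
  -- Let `ψ x = f` and `x g = f b`. Then `f g = ψ(f) σ(b)`, so comparing degrees forces `b` to have
  -- degree zero and both `ψ f` and `x` to have the degree of `f`. Hence `ψ f = f c` and `x = f d`,
  -- and `f = ψ(x) = f c d`.
  obtain ⟨c, hc, d, hd, hψf, hcd⟩ : ∃ c ∈ polyDel k, ∃ d ∈ polyDel k, ψ f = f * c ∧ c * d = 1 := by
    obtain ⟨x, hx, hψx⟩ := hψs f hf.1
    obtain ⟨g, hg, hg0, b, hb⟩ := exists_mul_eq_mul hf.1 hf0 hf.le hx
    have e1 : f * g = ψ f * σ b := by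
      rw [← hψm f hf.1, ← hb, hψm x hx, hψx, hσ g hg]
    have hb0 : b ≠ 0 := by
      rintro rfl
      rw [map_zero, mul_zero] at e1
      exact mul_ne_zero hf0 hg0 e1
    have hx0 : x ≠ 0 := by
      rintro rfl
      rw [zero_mul] at hb
      exact mul_ne_zero hf0 hb0 hb.symm
    have e2 := congrArg tDegree e1
    have e3 := congrArg tDegree hb
    rw [tDegree_mul hf0 hg0, tDegree_mul hψf0 ((map_ne_zero_iff _ σ.injective).mpr hb0),
      tDegree_eq_zero_iff.mpr hg, tDegree_apply (hσ _ del_mem_polyDel)] at e2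
    rw [tDegree_mul hx0 hg0, tDegree_mul hf0 hb0, tDegree_eq_zero_iff.mpr hg] at e3
    have hle := hf.le _ (hψI f hf.1) hψf0
    obtain ⟨c, hc, hψf⟩ := hf.exists_eq (hψI f hf.1) (by omega)
    obtain ⟨d, hd, rfl⟩ := hf.exists_eq hx (by omega)
    refine ⟨c, hc, d, hd, hψf, mul_left_cancel₀ hf0 ?_⟩
    rw [← mul_assoc, ← hψf, mul_one, ← hσ d hd, ← hψm f hf.1, hψx]
  obtain ⟨r, rfl⟩ := exists_algebraMap_eq_of_mul_eq_one hc hd hcd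
  have hr : r ≠ 0 := by
    rintro rfl
    rw [map_zero, zero_mul] at hcd
    exact zero_ne_one hcd
  obtain ⟨x, hx, e⟩ := ha
  rw [← Submodule.smul_mem_iff _ hr]
  refine ⟨ψ x, hψI x hx, ?_⟩
  rw [Algebra.smul_def, ← mul_assoc, ← hψf, ← hψm f hf.1, e, hψm x hx, hσ h hh]

/-- A polynomial in `r ∈ k` with coefficients in a vector space, all whose values lie in a subspace,
has its coefficients in this subspace. -/
lemma mem_of_forall_sum_smul_mem {K M : Type*} [Field K] [CharZero K] [AddCommGroup M] [Module K M]
    {S : Submodule K M} {N : ℕ} {y : ℕ → M}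
    (h : ∀ r : K, ∑ i ∈ Finset.range N, r ^ i • y i ∈ S) {j : ℕ} (hj : j < N) : y j ∈ S := by
  by_contra hy
  -- A functional vanishing on `S` but not at `y j` yields a scalar polynomial that is zero at every
  -- point of the infinite field `K`, yet has a non-zero coefficient.
  obtain ⟨φ, hφ, hφS⟩ := Submodule.exists_le_ker_of_notMem hy
  have h0 : (∑ i ∈ Finset.range N, monomial i (φ (y i)) : K[X]) = 0 := by
    refine Polynomial.funext fun r => ?_
    have h1 : φ (∑ i ∈ Finset.range N, r ^ i • y i) = 0 := hφS (h r)
    rw [map_sum] at h1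
    simp only [map_smul, smul_eq_mul] at h1
    rw [eval_finsetSum, eval_zero, ← h1]
    exact Finset.sum_congr rfl fun i _ => by rw [eval_monomial, mul_comm]
  have h1 := congrArg (fun P : K[X] => P.coeff j) h0
  simp only [finsetSum_coeff, coeff_monomial, coeff_zero] at h1
  rw [Finset.sum_ite_eq' (Finset.range N) j, if_pos (Finset.mem_range.mpr hj)] at h1
  exact hφ h1

/-- This differentiates the one-parameter group `exp(ad r P(∂))` at `r = 0`: its values on `a` are
polynomial in `r`, and the linear coefficient is `ad P(∂) a`. -/
lemma mul_mem_quotientSubmodule_of_mem_stafford {I : RightIdeal k} {f : A₁ k}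
    (hf : IsCharElem I f) (hf0 : f ≠ 0) {P : k[X]} (hP : ∀ r : k, expAut (r • P) ∈ stafford I)
    {h a : A₁ k} (hh : h ∈ polyDel k) (ha : a ∈ quotientSubmodule I f h) :
    aeval (del k) P * a ∈ quotientSubmodule I f h := by
  rw [← ad_mem_quotientSubmodule_iff (commute_of_mem_polyDel (aeval_del_mem P) hh) ha]
  obtain ⟨N, hN⟩ := exists_ad_pow_eq_zero P a
  -- The padding guarantees that the sum contains the index `1`, even when `N = 0`.
  have hN2 := ad_pow_eq_zero_of_le (show N ≤ N + 2 by omega) hN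
  have hsum : ∀ r : k, ∑ i ∈ Finset.range (N + 2),
      r ^ i • ((i.factorial : k)⁻¹ • (ad k (aeval (del k) P) ^ i) a) ∈ quotientSubmodule I f h := by
    intro r
    have had : ad k (aeval (del k) (r • P)) = r • ad k (aeval (del k) P) := by
      refine LinearMap.ext fun x => ?_
      rw [LinearMap.smul_apply, ad_apply, ad_apply, map_smul, smul_mul_assoc, mul_smul_comm,
        smul_sub]
    have h1 := apply_mem_quotientSubmodule hf hf0 (σ := expAut (r • P))
      (fun c hc => expHom_of_mem _ hc) (hP r) hh ha
    rw [expAut_apply, expHom_apply (N := N + 2)] at h1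
    · convert h1 using 2 with i
      rw [had, _root_.smul_pow, LinearMap.smul_apply, smul_comm]
    · rw [had, _root_.smul_pow, LinearMap.smul_apply, hN2, smul_zero]
  simpa using mem_of_forall_sum_smul_mem hsum (show 1 < N + 2 by omega)

end Quotients

/-! ### Descent to `A₁` and the comparison of `V` with `W` -/

section Main

variable {k : Type*} [Field k]

/-- The derivative of `b ^ 2 * p` is divisible by `b`. So `V` contains a non-zero ideal, and
multiplication by its generator is a non-zero element of `diffIdeal V`. -/
lemma mul_sq_mem_of_ringO_subset {V : Submodule k k[X]} {b v : k[X]}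
    (hb : ringO b ⊆ stabilizer V) (hv : v ∈ V) (p : k[X]) : b ^ 2 * v * p ∈ V := by
  have h : b ^ 2 * p ∈ ringO b := by
    refine Ideal.mem_span_singleton.mpr ?_
    rw [derivative_mul, derivative_sq]
    exact ⟨2 * derivative b * p + b * derivative p, by simp only [map_ofNat]; ring⟩
  rw [mul_right_comm]
  exact hb h v hv

lemma diffIdeal_ne_bot {V : Submodule k k[X]} (hV : IsPrimaryDecomposable V) :
    diffIdeal V ≠ ⊥ := by
  obtain ⟨hV0, b, hb0, hb⟩ := hV
  obtain ⟨v, hv, hv0⟩ := (Submodule.ne_bot_iff V).mp hV0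
  have hact : ∀ p q : k[X], act k (aeval (t k) p) q = p * q := by
    intro p q
    rw [← aeval_algHom_apply]
    change aeval (LinearMap.mulLeft k (X : k[X])) p q = p * q
    have h := aeval_algHom_apply (Algebra.lmul k k[X]) (X : k[X]) p
    rw [aeval_X_left_apply] at h
    exact LinearMap.congr_fun h q
  refine (Submodule.ne_bot_iff _).mpr ⟨aeval (t k) (b ^ 2 * v), fun p => ?_, fun h => ?_⟩
  · rw [hact]; exact mul_sq_mem_of_ringO_subset hb hv p
  · have h1 := hact (b ^ 2 * v) 1
    rw [h, map_zero, LinearMap.zero_apply, mul_one] at h1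
    exact mul_ne_zero (pow_ne_zero 2 hb0) hv0 h1.symm

variable [CharZero k]

/-- The largest `(k[∂], A₁)`-subbimodule `J` of `Q₁` such that `f v J` is contained in `I`. -/
def largestBimodule (I : RightIdeal k) (f v : A₁ k) : AddSubgroup (Q₁ k) where
  carrier := {u | ∀ r ∈ polyDel k, ∃ x ∈ I, toQ k (f * (v * r)) * u = toQ k x}
  zero_mem' r _ := ⟨0, I.zero_mem, by simp⟩
  add_mem' := by
    intro u w hu hw r hr
    obtain ⟨x, hx, e⟩ := hu r hr
    obtain ⟨y, hy, e'⟩ := hw r hr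
    exact ⟨x + y, I.add_mem hx hy, by rw [mul_add, e, e', map_add]⟩
  neg_mem' := by
    intro u hu r hr
    obtain ⟨x, hx, e⟩ := hu r hr
    exact ⟨-x, I.neg_mem hx, by rw [mul_neg, e, map_neg]⟩

lemma mul_mem_largestBimodule {I : RightIdeal k} {f v : A₁ k} {u : Q₁ k}
    (hu : u ∈ largestBimodule I f v) (a : A₁ k) : u * toQ k a ∈ largestBimodule I f v := by
  intro r hr
  obtain ⟨x, hx, e⟩ := hu r hr
  exact ⟨x * a, mul_mem_of_mem hx _, by rw [← mul_assoc, e, map_mul]⟩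

lemma polyDel_mul_mem_largestBimodule {I : RightIdeal k} {f v : A₁ k} {u : Q₁ k}
    (hu : u ∈ largestBimodule I f v) {c : A₁ k} (hc : c ∈ polyDel k) :
    toQ k c * u ∈ largestBimodule I f v := by
  intro r hr
  obtain ⟨x, hx, e⟩ := hu (r * c) (mul_mem hr hc)
  exact ⟨x, hx, by rw [← e, ← mul_assoc, ← map_mul]; simp only [mul_assoc]⟩

lemma ad_del_pow_mem_largestBimodule {I : RightIdeal k} {f v : A₁ k} {u : Q₁ k}
    (hu : u ∈ largestBimodule I f v) (n : ℕ) :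
    (ad ℤ (toQ k (del k)) ^ n) u ∈ largestBimodule I f v := by
  induction n with
  | zero => exact hu
  | succ n ih =>
    rw [pow_succ', Module.End.mul_apply, ad_apply]
    exact sub_mem (polyDel_mul_mem_largestBimodule ih del_mem_polyDel)
      (mul_mem_largestBimodule ih _)

/-- The bimodule is stable under `ad ∂`, so it contains the leading coefficient `c` of `u`. Since `f
v c ∈ I` and `v c` commutes with `∂`, the characteristic property of `f` gives `v c ∈ k[∂]`; the
leading term can then be removed. -/
lemma exists_mul_eq_toQ_of_mem_largestBimodule {I : RightIdeal k} {f v : A₁ k}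
    (hf : IsCharElem I f) (hf0 : f ≠ 0) (hv : v ∈ polyDel k) {n : ℕ} {u : Q₁ k}
    (hu : u ∈ largestBimodule I f v) (hn : (ad ℤ (toQ k (del k)) ^ n) u = 0) :
    ∃ b, toQ k v * u = toQ k b := by
  induction n generalizing u with
  | zero =>
    have : u = 0 := by simpa using hn
    exact ⟨0, by simp [this]⟩
  | succ n ih =>
    set c := (ad ℤ (toQ k (del k)) ^ n) u with hc
    have hcJ : c ∈ largestBimodule I f v := ad_del_pow_mem_largestBimodule hu n
    have hcc : Commute (toQ k (del k)) c := by
      rw [pow_succ', Module.End.mul_apply] at hn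
      exact commute_of_ad_eq_zero hn
    obtain ⟨x, hx, e⟩ := hcJ 1 (one_mem _)
    rw [mul_one, map_mul, mul_assoc] at e
    have hvc : Commute (toQ k (del k)) (toQ k v * c) :=
      ((commute_del hv).map (toQ k)).mul_right hcc
    obtain ⟨d, hd, hvd⟩ := mem_polyDel_of_toQ hf hf0 hvc hx e
    have hfac : (n.factorial : k) ≠ 0 := Nat.cast_ne_zero.mpr n.factorial_ne_zero
    -- Normalised so that `(ad ∂) ^ n` sends `s` to `1`; then `u - c s` has a smaller nilpotency
    -- order.
    set s : A₁ k := (n.factorial : k)⁻¹ • t k ^ n with hs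
    have hs1 : (ad k (del k) ^ n) s = 1 := by
      rw [hs, map_smul, (ad_del_pow_t_pow n).2, ← Nat.cast_smul_eq_nsmul k, smul_smul,
        inv_mul_cancel₀ hfac, one_smul]
    obtain ⟨b, hb⟩ := ih (sub_mem hu (mul_mem_largestBimodule hcJ s)) (by
      rw [map_sub, ad_pow_commute_mul hcc, ad_toQ_pow, hs1, map_one, mul_one, ← hc, sub_self])
    refine ⟨b + d * s, ?_⟩
    rw [map_add, ← hb, map_mul, ← hvd, mul_sub, mul_assoc, sub_add_cancel]

lemma exists_eq_mul_of_forall_mul_mem {I : RightIdeal k} {f : A₁ k} (hf : IsCharElem I f)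
    (hf0 : f ≠ 0) {e : Q₁ k} (he : IsDualCharElem I e) {v : A₁ k} (hv : v ∈ polyDel k)
    (hv0 : v ≠ 0)
    (hI : ∀ r ∈ polyDel k, ∀ h ∈ polyDel k, ∀ a ∈ quotientSubmodule I f h,
      v * r * a ∈ quotientSubmodule I f h) :
    ∃ c ∈ polyDel k, toQ k v = e * toQ k f * toQ k c := by
  have hQf := toQ_ne_zero hf0
  -- By `hI`, the module `f⁻¹ I` lies in `largestBimodule I f v`, and `ad ∂` is nilpotent on each `a
  -- h⁻¹` because `h` commutes with `∂`.
  have hdual : toQ k v * (toQ k f)⁻¹ ∈ dual I := by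
    intro y hy
    obtain ⟨h, hh, hh0, a, ha⟩ := exists_mul_eq_mul hf.1 hf0 hf.le hy
    have hQh := toQ_ne_zero hh0
    have hya : (toQ k f)⁻¹ * toQ k y = toQ k a * (toQ k h)⁻¹ := by
      rw [eq_mul_inv_iff_mul_eq₀ hQh, mul_assoc, ← map_mul, ha, map_mul, inv_mul_cancel_left₀ hQf]
    rw [mul_assoc, hya]
    obtain ⟨n, hn⟩ := exists_ad_del_pow_eq_zero a
    refine exists_mul_eq_toQ_of_mem_largestBimodule hf hf0 hv (n := n) ?_ ?_
    · intro r hr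
      obtain ⟨x, hx, e⟩ := hI r hr h hh a ⟨y, hy, ha.symm⟩
      refine ⟨x, hx, ?_⟩
      rw [← mul_assoc, ← map_mul, mul_assoc f, e, map_mul, mul_inv_cancel_right₀ hQh]
    · rw [ad_pow_mul_of_commute ((commute_del hh).map (toQ k)).inv_right₀, ad_toQ_pow, hn, map_zero,
        zero_mul]
  have hvf : toQ k v * (toQ k f)⁻¹ * toQ k f = toQ k v := by
    rw [mul_assoc, inv_mul_cancel₀ hQf, mul_one]
  obtain ⟨c, hc, e1⟩ := he.exists_eq hf.1 hf0 hdual hv hv0 hvf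
  obtain ⟨w, hw, e2⟩ := exists_polyDel_eq_mul hf hf0 he
  refine ⟨c, hc, ?_⟩
  rw [← hvf, e1, mul_assoc, e2, ← map_mul, ← map_mul, (commute_of_mem_polyDel hc hw).eq]

/-- With `v = e f`, one has `v r f⁻¹ I = r e I ⊆ A₁ ⊆ f⁻¹ I`; the last inclusion holds because `f ∈
I`. -/
lemma polyDel_mul_mem_quotientSubmodule {I : RightIdeal k} {f : A₁ k} {e : Q₁ k} (hf : f ∈ I)
    (he : e ∈ dual I) {v : A₁ k} (hv : v ∈ polyDel k) (hev : e * toQ k f = toQ k v) {r h a : A₁ k}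
    (hr : r ∈ polyDel k) (ha : a ∈ quotientSubmodule I f h) :
    v * r * a ∈ quotientSubmodule I f h := by
  obtain ⟨x, hx, e1⟩ := ha
  obtain ⟨b, hb⟩ := he x hx
  have e2 : v * a = b * h := toQ_injective k (by
    rw [map_mul, map_mul, ← hev, ← hb, mul_assoc, mul_assoc, ← map_mul, ← map_mul, e1])
  refine ⟨f * (r * b), mul_mem_of_mem hf _, ?_⟩
  rw [(commute_of_mem_polyDel hv hr).eq, mul_assoc, e2]
  simp only [mul_assoc]

end Main

end Weyl

theorem mainTheorem6 {k : Type*} [Field k] [CharZero k] (V W : Submodule k k[X])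
    (hV : Weyl.IsPDI V) (hW : Weyl.IsPDI W)
    (hVW : Weyl.stafford (Weyl.diffIdeal V) ⊆ Weyl.stafford (Weyl.diffIdeal W))
    (eV eW : Weyl.Q₁ k) (fV fW : Weyl.A₁ k)
    (heV : Weyl.IsDualCharElem (Weyl.diffIdeal V) eV) (hfV : Weyl.IsCharElem (Weyl.diffIdeal V) fV)
    (heW : Weyl.IsDualCharElem (Weyl.diffIdeal W) eW)
    (hfW : Weyl.IsCharElem (Weyl.diffIdeal W) fW) :
    ∃ c ∈ Weyl.polyDel k,
      eV * Weyl.toQ k fV = eW * Weyl.toQ k fW * Weyl.toQ k c := by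
  have hfV0 := hfV.ne_zero (Weyl.diffIdeal_ne_bot hV.1)
  have hfW0 := hfW.ne_zero (Weyl.diffIdeal_ne_bot hW.1)
  obtain ⟨v, hv, hev⟩ := Weyl.exists_polyDel_eq_mul hfV hfV0 heV
  rw [hev]
  by_cases hv0 : v = 0
  · exact ⟨0, zero_mem _, by simp [hv0]⟩
  refine Weyl.exists_eq_mul_of_forall_mul_mem hfW hfW0 heW hv hv0 fun r hr h hh a ha => ?_
  -- Every scalar multiple of `v r` is again in `v k[∂]`, so the whole one-parameter group generated
  -- by `P` lies in `H(V)`, hence in `H(W)`.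
  obtain ⟨P, hP⟩ := Weyl.mem_polyDel.mp (mul_mem hv hr)
  rw [hP]
  refine Weyl.mul_mem_quotientSubmodule_of_mem_stafford hfW hfW0 (fun s => hVW ?_) hh ha
  refine Weyl.expAut_mem_stafford hfV.1 hfV0 hfV.le fun h' _ a' ha' => ?_
  rw [map_smul, ← hP, ← mul_smul_comm]
  exact Weyl.polyDel_mul_mem_quotientSubmodule hfV.1 heV.1 hv hev
    ((Weyl.polyDel k).smul_mem hr s) ha'
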